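/- Let $d$ and $n$ be positive integers with $n\le d/2$, let $K$ be an algebraically closed field of characteristic other than two, and fix $i\in K$ with $i^2=-1$. Let $Y=(y_{jk})$ be a $d\times n$ matrix of indeterminates over $K$, let $S=K[Y]$ be the polynomial ring in its entries, and let $(Y^{\mathrm{tr}}Y)$ be the ideal of $S$ generated by the entries of $Y^{\mathrm{tr}}Y$. For an ideal $\mathfrak a$ of $S$, let $V(\mathfrak a)\subseteq K^{d\times n}$ be its set of zeros, with the Zariski topology. For an integer $a$ with $0\le a<n$ put $J_a=(y_{11},\dots,y_{1a})S$ and $I=(Y^{\mathrm{tr}}Y)+J_a$. When $d=2t$ is even with $t\le n$, put $\mathfrak S=(Y^{\mathrm{tr}}Y)+I_{t+1}(Y)$, where $I_{t+1}(Y)$ is generated by the minors of $Y$ of size $t+1$ (so that $I_{t+1}(Y)=0$ if $t=n$). For a subset $\alpha$ of $\{1,\dots,d\}$ with complement $\alpha^{\mathrm c}$, let $\operatorname{sgn}(\alpha)$ be the sign of the permutation sending $(1,\dots,d)$ to $(\alpha,\alpha^{\mathrm c})$, the entries of each of $\alpha,\alpha^{\mathrm c}$ being in ascending order, and for $\beta\subseteq\{1,\dots,n\}$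 let $Y_{\alpha|\beta}$ be the submatrix of $Y$ with rows $\alpha$ and columns $\beta$. Let $\mathfrak P$ (respectively $\mathfrak Q$) be the ideal of $S$ generated by $\mathfrak S$ and the polynomials $$\det(Y_{\alpha|\beta})-i^{t}\operatorname{sgn}(\alpha)\det(Y_{\alpha^{\mathrm c}|\beta})\qquad\bigl(\text{respectively }\ \det(Y_{\alpha|\beta})+i^{t}\operatorname{sgn}(\alpha)\det(Y_{\alpha^{\mathrm c}|\beta})\bigr)$$ for all subsets $\alpha\subseteq\{1,\dots,d\}$ and $\beta\subseteq\{1,\dots,n\}$ of size $t$. 1. If $n<d/2$, then $V(I)$ is irreducible. 2. If $n=d/2$, then $V(I)$ has exactly two irreducible components, namely the distinct sets $V(\mathfrak P+J_a)$ and $V(\mathfrak Q+J_a)$. Moreover, in this case $(Y^{\mathrm{tr}}Y)$ is a radical ideal and $(Y^{\mathrm{tr}}Y)=\mathfrak P\cap\mathfrak Q$. -/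

import Mathlib

noncomputable section

namespace SymmetricNullcone

open MvPolynomial

theorem zeroLocus_union {K σ : Type*} [Field K] (I J : Ideal (MvPolynomial σ K)) :
    zeroLocus K I ∪ zeroLocus K J = zeroLocus K (I ⊓ J) := by
  apply Set.Subset.antisymm
  · exact Set.union_subset (zeroLocus_anti_mono inf_le_left) (zeroLocus_anti_mono inf_le_right)
  · intro x hx
    by_contra hcon
    rw [Set.mem_union, not_or] at hcon
    obtain ⟨h1, h2⟩ := hcon
    simp only [mem_zeroLocus_iff, not_forall] at h1 h2
    obtain ⟨p, hp, hp0⟩ := h1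
    obtain ⟨q, hq, hq0⟩ := h2
    have h := (mem_zeroLocus_iff.1 hx) (p * q)
      ⟨Ideal.mul_mem_right q I hp, Ideal.mul_mem_left J p hq⟩
    rw [map_mul] at h
    exact (mul_ne_zero hp0 hq0) h

theorem zeroLocus_sInter {K σ : Type*} [Field K] (A : Set (Set (σ → K)))
    (hA : A ⊆ {Z | ∃ I : Ideal (MvPolynomial σ K), Z = zeroLocus K I}) :
    ⋂₀ A = zeroLocus K (sSup {I : Ideal (MvPolynomial σ K) | zeroLocus K I ∈ A}) := by
  apply Set.Subset.antisymm
  · intro x hx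
    have h : sSup {I : Ideal (MvPolynomial σ K) | zeroLocus K I ∈ A} ≤ vanishingIdeal K {x} := by
      refine sSup_le fun I hI p hp => ?_
      rw [mem_vanishingIdeal_singleton_iff]
      exact (mem_zeroLocus_iff.1 (hx _ hI)) p hp
    exact mem_zeroLocus_iff.2 fun p hp => (mem_vanishingIdeal_singleton_iff x p).1 (h hp)
  · intro x hx Z hZ
    obtain ⟨I, rfl⟩ := hA hZ
    exact zeroLocus_anti_mono (le_sSup hZ) hx

/-- The Zariski topology on the affine space `σ → K`: the closed sets are the algebraic sets
`V(I) = MvPolynomial.zeroLocus K I`, for `I` an ideal of the polynomial ring. -/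
@[reducible] def zariskiTopology (K σ : Type*) [Field K] : TopologicalSpace (σ → K) :=
  TopologicalSpace.ofClosed {Z | ∃ I : Ideal (MvPolynomial σ K), Z = zeroLocus K I}
    ⟨⊤, zeroLocus_top.symm⟩
    (fun A hA => ⟨_, zeroLocus_sInter A hA⟩)
    (by
      rintro _ ⟨I, rfl⟩ _ ⟨J, rfl⟩
      exact ⟨_, zeroLocus_union I J⟩)

/-- A subset of affine space is irreducible if it is nonempty and is not the union of two proper
relatively closed subsets, in the Zariski topology. -/
def IsZariskiIrreducible {K σ : Type*} [Field K] (Z : Set (σ → K)) : Prop :=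
  @IsIrreducible (σ → K) (zariskiTopology K σ) Z

/-- The irreducible components of a subset `V` of affine space: the maximal irreducible subsets
of `V`. -/
def zariskiComponents {K σ : Type*} [Field K] (V : Set (σ → K)) : Set (Set (σ → K)) :=
  {Z | Maximal (fun W => W ⊆ V ∧ IsZariskiIrreducible W) Z}

/-- The polynomial ring `K[Y]` in the entries of a `d × n` matrix of indeterminates. -/
abbrev PolyRing (K : Type*) [Field K] (d n : ℕ) : Type _ :=
  MvPolynomial (Fin d × Fin n) K

/-- The `d × n` matrix of indeterminates `Y`. -/
abbrev genMatrix (K : Type*) [Field K] (d n : ℕ) : Matrix (Fin d) (Fin n) (PolyRing K d n) :=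
  Matrix.mvPolynomialX (Fin d) (Fin n) K

/-- The ideal `(Yᵗ Y)` generated by the entries of `Yᵗ Y`. -/
def gramIdeal (K : Type*) [Field K] (d n : ℕ) : Ideal (PolyRing K d n) :=
  Ideal.span {p | ∃ j k : Fin n, p = ((genMatrix K d n).transpose * genMatrix K d n) j k}

/-- The ideal `J_a = (y₁₁, …, y₁ₐ)` generated by the first `a` entries of the first row of `Y`
(rows and columns are numbered from `0` here). -/
def rowIdeal (K : Type*) [Field K] (d n a : ℕ) : Ideal (PolyRing K d n) :=
  Ideal.span {p | ∃ (r : Fin d) (j : Fin n),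
    (r : ℕ) = 0 ∧ (j : ℕ) < a ∧ p = genMatrix K d n r j}

/-- The determinantal ideal `I_k(Y)` generated by the `k × k` minors of `Y`. -/
def minorsIdeal (K : Type*) [Field K] (d n k : ℕ) : Ideal (PolyRing K d n) :=
  Ideal.span {p | ∃ (r : Fin k ↪o Fin d) (c : Fin k ↪o Fin n),
    p = ((genMatrix K d n).submatrix r c).det}

/-- The ideal `𝔖 = (Yᵗ Y) + I_{t+1}(Y)`, where `t = ⌊d/2⌋`. -/
def idealS (K : Type*) [Field K] (d n : ℕ) : Ideal (PolyRing K d n) :=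
  gramIdeal K d n ⊔ minorsIdeal K d n (d / 2 + 1)

theorem card_add_card_compl {m : ℕ} (α : Finset (Fin m)) : m = α.card + αᶜ.card := by
  rw [Finset.card_add_card_compl, Fintype.card_fin]

/-- `sgn(α)`: the sign of the permutation that sends `(1, …, m)` to `(α, αᶜ)`, where the entries
of `α` and of its complement are listed in ascending order. -/
def sgn {m : ℕ} (α : Finset (Fin m)) : ℤˣ :=
  Equiv.Perm.sign ((finCongr (card_add_card_compl α)).trans
    (finSumFinEquiv.symm.trans (finSumEquivOfFinset (s := α) rfl rfl)))

/-- The minor `det (Y_{α|β})` with rows `α` and columns `β`, both in ascending order. -/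
def minorDet (K : Type*) [Field K] {d n t : ℕ} (α : Finset (Fin d)) (hα : α.card = t)
    (β : Finset (Fin n)) (hβ : β.card = t) : PolyRing K d n :=
  ((genMatrix K d n).submatrix (α.orderEmbOfFin hα) (β.orderEmbOfFin hβ)).det

/-- The ideal `𝔓` for `Y` of size `d × n` with `d = 2t`, where `i² = -1`: it is generated by `𝔖`
and all `det (Y_{α|β}) - iᵗ sgn(α) det (Y_{αᶜ|β})` with `α`, `β` of size `t`. (The condition that
`αᶜ` has size `t` is automatic for `d = 2t`.) -/
def idealP {K : Type*} [Field K] (i : K) (d n t : ℕ) : Ideal (PolyRing K d n) :=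
  idealS K d n ⊔ Ideal.span {p | ∃ (α : Finset (Fin d)) (hα : α.card = t) (hαc : αᶜ.card = t)
    (β : Finset (Fin n)) (hβ : β.card = t),
    p = minorDet K α hα β hβ - C (i ^ t) * ((sgn α : ℤ) : PolyRing K d n) * minorDet K αᶜ hαc β hβ}

/-- The ideal `𝔔` for `Y` of size `d × n` with `d = 2t`, where `i² = -1`: it is generated by `𝔖`
and all `det (Y_{α|β}) + iᵗ sgn(α) det (Y_{αᶜ|β})` with `α`, `β` of size `t`. -/
def idealQ {K : Type*} [Field K] (i : K) (d n t : ℕ) : Ideal (PolyRing K d n) :=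
  idealS K d n ⊔ Ideal.span {p | ∃ (α : Finset (Fin d)) (hα : α.card = t) (hαc : αᶜ.card = t)
    (β : Finset (Fin n)) (hβ : β.card = t),
    p = minorDet K α hα β hβ + C (i ^ t) * ((sgn α : ℤ) : PolyRing K d n) * minorDet K αᶜ hαc β hβ}

end SymmetricNullcone

end

/-! Geometry. Put n = m + 1 and let e be the first coordinate vector, so a point of V(I) is a matrix
Y whose columns span a totally isotropic space and whose first a columns are orthogonal to e.
Enlarge the column space to an isotropic E of dimension n and choose inside E ∩ e^⊥ a subspace F of
dimension m containing the first a columns. Even products of reflections fixing e act transitively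
on bases of such F (`exists_evenGroup_frame`). Hence, with one fixed frame f, every Y is g [f | l] M
with g such a product, l isotropic in f^⊥ outside span f, and M in a linear space of matrices
(`exists_decomposition`). Irreducibility comes from rational curves. Moving the vector of a
reflection along a line joins products of reflections by polynomial curves up to scalars, M moves
along a line, and a set whose points are pairwise joined by such curves is irreducible
(`isZariskiIrreducible_of_curves`, `isZariskiIrreducible_orbit`). If 2n < d, even products fixing f
also act transitively on the vectors l, so V(I) is a single irreducible family
(`isZariskiIrreducible_nullCone`). If 2n = d, the plane f^⊥ / span f has exactly two isotropic
lines, interchanged by a reflection, so V(I) is a union of two irreducible orbits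
(`IsHyperbolicPair.nullCone_eq`). The orbits are told apart by self-duality. A full-rank isotropic Y
satisfies det(XᵀY) = ±iⁿ det[X | Y] for all X (`exists_selfDual`); even products preserve the sign
and a reflection changes it. Taking coordinate columns for X gives the relations defining 𝔓 or 𝔔,
and rank-deficient matrices lie in both orbits, so these relations cut out the orbits exactly
(`IsHyperbolicPair.orbit_eq`). Algebra. For d = 2n, a linear change of variables turns YᵀY into
2(AᵀB + BᵀA). Suitable weights give its entries squarefree, pairwise coprime leading monomials, so
they form a Gröbner basis of a radical ideal (`isRadical_gramIdeal`). With V(YᵀY) = V(𝔓 ∩ 𝔔), the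
Nullstellensatz gives the intersection formula (`gramIdeal_eq_inf`). -/

noncomputable section

namespace SymmetricNullcone

open MvPolynomial

/-! ### Monomial orders refining a weight -/

section WeightOrder

variable {σ : Type*}

/-- Exponent vectors, to be compared first by weight and then lexicographically. -/
def WeightLex (_ : σ → ℕ) : Type _ := σ →₀ ℕ

instance (w : σ → ℕ) : AddCommMonoid (WeightLex w) := inferInstanceAs (AddCommMonoid (σ →₀ ℕ))

/-- The exponent vector underlying an element of `WeightLex w`. -/
def WeightLex.exponent {w : σ → ℕ} : WeightLex w ≃+ (σ →₀ ℕ) := AddEquiv.refl _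

/-- The weight of an exponent vector together with the vector itself. -/
def weightLexKey (w : σ → ℕ) (x : WeightLex w) : ℕ ×ₗ Lex (σ →₀ ℕ) :=
  toLex (Finsupp.weight w x.exponent, toLex x.exponent)

theorem weightLexKey_injective (w : σ → ℕ) : Function.Injective (weightLexKey w) := by
  intro x y h
  have := congrArg (fun z => ofLex (ofLex z).2) h
  exact WeightLex.exponent.injective this

variable [LinearOrder σ]

instance (w : σ → ℕ) : LinearOrder (WeightLex w) :=
  LinearOrder.lift' (weightLexKey w) (weightLexKey_injective w)

theorem weightLex_le_iff {w : σ → ℕ} {x y : WeightLex w} :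
    x ≤ y ↔ Finsupp.weight w x.exponent < Finsupp.weight w y.exponent ∨
      Finsupp.weight w x.exponent = Finsupp.weight w y.exponent ∧
        toLex x.exponent ≤ toLex y.exponent :=
  Prod.Lex.toLex_le_toLex

instance (w : σ → ℕ) : IsOrderedAddMonoid (WeightLex w) where
  add_le_add_left a b h c := by
    rw [weightLex_le_iff] at h ⊢
    simpa only [map_add, toLex_add, add_lt_add_iff_right, add_left_inj, add_le_add_iff_right]
      using h

instance [WellFoundedGT σ] (w : σ → ℕ) : WellFoundedLT (WeightLex w) :=
  ⟨InvImage.wf (weightLexKey w) (wellFounded_lt (α := ℕ ×ₗ Lex (σ →₀ ℕ)))⟩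

/-- The monomial order that compares weights first and breaks ties lexicographically. -/
def weightOrder [WellFoundedGT σ] (w : σ → ℕ) : MonomialOrder σ where
  syn := WeightLex w
  toSyn := WeightLex.exponent.symm
  toSyn_monotone := by
    intro x y h
    rw [weightLex_le_iff]
    simp only [AddEquiv.apply_symm_apply]
    have hw : Finsupp.weight w x ≤ Finsupp.weight w y := by
      rw [← tsub_add_cancel_of_le h, map_add]
      exact le_add_self
    rcases hw.lt_or_eq with h1 | h1
    · exact Or.inl h1
    · exact Or.inr ⟨h1, Finsupp.toLex_monotone h⟩

theorem weightOrder_le_of_weight_lt [WellFoundedGT σ] {w : σ → ℕ} {x y : σ →₀ ℕ}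
    (h : Finsupp.weight w x < Finsupp.weight w y) :
    (weightOrder w).toSyn x ≤ (weightOrder w).toSyn y := by
  refine weightLex_le_iff.2 (Or.inl ?_)
  exact h

theorem weightOrder_degree_eq [WellFoundedGT σ] {R : Type*} [CommSemiring R] {w : σ → ℕ}
    {f : MvPolynomial σ R} {e : σ →₀ ℕ} (he : f.coeff e ≠ 0)
    (hlt : ∀ c ∈ f.support, c ≠ e → Finsupp.weight w c < Finsupp.weight w e) :
    (weightOrder w).degree f = e := by
  apply (weightOrder w).toSyn.injective
  apply le_antisymm
  · rw [MonomialOrder.degree_le_iff]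
    intro c hc
    by_cases h : c = e
    · rw [h]
    · exact weightOrder_le_of_weight_lt (hlt c hc h)
  · exact MonomialOrder.le_degree (mem_support_iff.2 he)

end WeightOrder

/-! ### Gröbner bases with coprime leading monomials, and radicality -/

section Coprime

variable {σ K ι : Type*} [Field K] (m : MonomialOrder σ)

theorem exists_remainder (f : ι → MvPolynomial σ K) (hf : ∀ p, f p ≠ 0) (s : Set ι)
    (g : MvPolynomial σ K) :
    ∃ r, g - r ∈ Ideal.span (f '' s) ∧ ∀ c ∈ r.support, ∀ p ∈ s, ¬ m.degree (f p) ≤ c := by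
  obtain ⟨q, r, h1, -, h3⟩ := m.div_set (B := f '' s) (fun b hb => by
    obtain ⟨p, -, rfl⟩ := hb
    exact isUnit_iff_ne_zero.2 (m.leadingCoeff_ne_zero_iff.2 (hf p))) g
  refine ⟨r, ?_, fun c hc p hp => h3 c hc _ ⟨p, hp, rfl⟩⟩
  rw [h1, add_sub_cancel_right, Finsupp.linearCombination_apply]
  refine Submodule.sum_mem _ fun b _ => ?_
  exact Ideal.mul_mem_left _ _ (Ideal.subset_span b.2)

/-- Polynomials whose leading monomials are pairwise coprime form a Gröbner basis. -/
theorem exists_degree_le_of_mem_span (f : ι → MvPolynomial σ K) (hf : ∀ p, f p ≠ 0)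
    (hcop : ∀ p q, p ≠ q → ∀ v, m.degree (f p) v = 0 ∨ m.degree (f q) v = 0) (s : Finset ι) :
    ∀ h ∈ Ideal.span (f '' s), h ≠ 0 → ∃ p ∈ s, m.degree (f p) ≤ m.degree h := by
  classical
  induction s using Finset.induction_on with
  | empty =>
    intro h hh h0
    simp at hh
    exact absurd hh h0
  | insert q s hq ih =>
    intro h hh h0
    rw [Finset.coe_insert, Set.image_insert_eq, Ideal.mem_span_insert] at hh
    obtain ⟨g, z, hz, rfl⟩ := hh
    -- Reducing the coefficient g modulo the earlier generators moves the difference into their span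
    -- and rules out cancellation of leading terms below.
    obtain ⟨r, hr1, hr2⟩ := exists_remainder m f hf (s : Set ι) g
    have hh' : (g - r) * f q + z ∈ Ideal.span (f '' s) :=
      Ideal.add_mem _ (Ideal.mul_mem_right _ _ hr1) hz
    set h' := (g - r) * f q + z with h'def
    have hsum : g * f q + z = r * f q + h' := by rw [h'def]; ring
    rw [hsum] at h0 ⊢
    by_cases hr0 : r = 0
    · rw [hr0, zero_mul, zero_add] at h0 ⊢
      obtain ⟨p, hp, hle⟩ := ih h' hh' h0
      exact ⟨p, Finset.mem_insert_of_mem hp, hle⟩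
    have hdeg : m.degree (r * f q) = m.degree r + m.degree (f q) := m.degree_mul hr0 (hf q)
    by_cases hh0 : h' = 0
    · refine ⟨q, Finset.mem_insert_self _ _, ?_⟩
      rw [hh0, add_zero, hdeg]
      exact le_add_self
    obtain ⟨p, hp, hle⟩ := ih h' hh' hh0
    have hpq : p ≠ q := fun h => hq (h ▸ hp)
    -- If the degrees agreed, the leading monomial of `f p` would divide that of r times that of `f
    -- q`; by coprimality it would divide that of r, which is reduced.
    have hne : m.degree (r * f q) ≠ m.degree h' := by
      intro heq
      refine hr2 _ (m.degree_mem_support hr0) p hp fun v => ?_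
      have h1 := hle v
      rw [← heq, hdeg, Finsupp.add_apply] at h1
      rcases hcop p q hpq v with h2 | h2 <;> omega
    have hd := m.degree_add_of_ne hne
    rcases le_total (m.toSyn (m.degree (r * f q))) (m.toSyn (m.degree h')) with h1 | h1
    · rw [sup_eq_right.2 h1] at hd
      rw [m.toSyn.injective hd]
      exact ⟨p, Finset.mem_insert_of_mem hp, hle⟩
    · rw [sup_eq_left.2 h1] at hd
      rw [m.toSyn.injective hd, hdeg]
      exact ⟨q, Finset.mem_insert_self _ _, le_add_self⟩

/-- Polynomials whose leading monomials are squarefree and pairwise coprime generate a radical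
ideal. -/
theorem isRadical_span_of_coprime_degree [Finite ι] (f : ι → MvPolynomial σ K)
    (hf : ∀ p, f p ≠ 0)
    (hcop : ∀ p q, p ≠ q → ∀ v, m.degree (f p) v = 0 ∨ m.degree (f q) v = 0)
    (hsq : ∀ p v, m.degree (f p) v ≤ 1) : (Ideal.span (Set.range f)).IsRadical := by
  classical
  cases nonempty_fintype ι
  rw [Ideal.isRadical_iff_pow_one_lt 2 one_lt_two]
  intro g hg
  obtain ⟨r, hr1, hr2⟩ := exists_remainder m f hf Set.univ g
  rw [Set.image_univ] at hr1
  by_cases hr0 : r = 0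
  · rwa [hr0, sub_zero] at hr1
  exfalso
  have h2 : r ^ 2 ∈ Ideal.span (f '' ((Finset.univ : Finset ι) : Set ι)) := by
    rw [Finset.coe_univ, Set.image_univ]
    have : r ^ 2 = g ^ 2 - (g - r) * (g + r) := by ring
    rw [this]
    exact Ideal.sub_mem _ hg (Ideal.mul_mem_right _ _ hr1)
  obtain ⟨p, -, hp⟩ := exists_degree_le_of_mem_span m f hf hcop _ _ h2 (pow_ne_zero 2 hr0)
  -- A squarefree monomial dividing the square of the leading monomial of r already divides that
  -- monomial.
  refine hr2 _ (m.degree_mem_support hr0) p trivial fun v => ?_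
  have h3 := hp v
  rw [m.degree_pow, Finsupp.smul_apply, smul_eq_mul] at h3
  have := hsq p v
  omega

/-- Polynomials whose parts of highest weight are squarefree and pairwise coprime monomials generate
a radical ideal. -/
theorem isRadical_span_of_weight [Finite σ] [Finite ι] (w : σ → ℕ) (f : ι → MvPolynomial σ K)
    (e : ι → σ →₀ ℕ) (he : ∀ p, (f p).coeff (e p) ≠ 0)
    (hlt : ∀ p, ∀ c ∈ (f p).support, c ≠ e p → Finsupp.weight w c < Finsupp.weight w (e p))
    (hcop : ∀ p q, p ≠ q → ∀ v, e p v = 0 ∨ e q v = 0) (hsq : ∀ p v, e p v ≤ 1) :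
    (Ideal.span (Set.range f)).IsRadical := by
  classical
  -- Any order of the variables serves: it only breaks ties, and the leading terms are decided by
  -- weight alone.
  let _ : LinearOrder σ := linearOrderOfSTO WellOrderingRel
  have hd : ∀ p, (weightOrder w).degree (f p) = e p := fun p => weightOrder_degree_eq (he p) (hlt p)
  refine isRadical_span_of_coprime_degree (weightOrder w) f (fun p h => he p ?_) ?_ ?_
  · rw [h, coeff_zero]
  · simpa only [hd] using hcop
  · simpa only [hd] using hsq

end Coprime

/-! ### Leading monomials of the entries of AᵗB + BᵗA -/

section Hyperbolic

variable (K : Type*) [Field K] (n : ℕ)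

/-- The exponent of `a_{rj} b_{rk}`. -/
def hypExp {n : ℕ} (j k r : Fin n) : (Fin n × Fin n) ⊕ (Fin n × Fin n) →₀ ℕ :=
  Finsupp.single (Sum.inl (r, j)) 1 + Finsupp.single (Sum.inr (r, k)) 1

/-- The `(j, k)` entry of `Aᵗ B + Bᵗ A`, for generic `n × n` matrices `A` and `B`. -/
def hypForm (j k : Fin n) : MvPolynomial ((Fin n × Fin n) ⊕ (Fin n × Fin n)) K :=
  ∑ r, (X (Sum.inl (r, j)) * X (Sum.inr (r, k)) + X (Sum.inr (r, j)) * X (Sum.inl (r, k)))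

/-- Weights that single out one monomial in each entry of `Aᵗ B + Bᵗ A`. -/
def hypWeight : (Fin n × Fin n) ⊕ (Fin n × Fin n) → ℕ
  | Sum.inl (r, j) => 2 * n * n - 2 * r * j
  | Sum.inr (r, k) => 2 * n * n + 2 * r * k - r * r

variable {n}

/-- Completing the square in 2r(k - j) - r² shows that the weight peaks exactly at r = k - j, an
admissible row index when j ≤ k. -/
theorem weight_hypExp (j k r : Fin n) :
    ((Finsupp.weight (hypWeight n) (hypExp j k r) : ℕ) : ℤ) =
      4 * n * n + ((k : ℤ) - j) ^ 2 - ((r : ℤ) - (k - j)) ^ 2 := by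
  have h1 : 2 * (r : ℕ) * j ≤ 2 * n * n := by
    have := Nat.mul_le_mul r.2.le j.2.le
    nlinarith
  have h2 : (r : ℕ) * r ≤ 2 * n * n + 2 * r * k := by
    have := Nat.mul_le_mul r.2.le r.2.le
    nlinarith
  rw [hypExp, map_add, Finsupp.weight_single, Finsupp.weight_single]
  simp only [hypWeight, one_smul]
  push_cast [Nat.cast_sub h1, Nat.cast_sub h2]
  ring

theorem weight_hypExp_lt {j k r : Fin n} (h : (j : ℕ) + r ≠ k) {r₀ : Fin n}
    (h₀ : (j : ℕ) + r₀ = k) : Finsupp.weight (hypWeight n) (hypExp j k r) <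
      Finsupp.weight (hypWeight n) (hypExp j k r₀) := by
  have h1 := weight_hypExp j k r
  have h2 := weight_hypExp j k r₀
  have h3 : ((r : ℤ) - (k - j)) ≠ 0 := by omega
  have h4 : ((r₀ : ℤ) - (k - j)) = 0 := by omega
  rw [h4] at h2
  have := sq_pos_of_ne_zero h3
  zify
  linarith

/-- For the transposed monomials the square becomes (r + (k - j))², which is positive for every r,
so none of them attains the peak. -/
theorem weight_hypExp_swap_lt {j k : Fin n} (h : j < k) (r : Fin n) {r₀ : Fin n}
    (h₀ : (j : ℕ) + r₀ = k) : Finsupp.weight (hypWeight n) (hypExp k j r) <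
      Finsupp.weight (hypWeight n) (hypExp j k r₀) := by
  have h1 := weight_hypExp k j r
  have h2 := weight_hypExp j k r₀
  have h4 : ((r₀ : ℤ) - (k - j)) = 0 := by omega
  have h5 : (0 : ℤ) < k - j := by
    have : (j : ℕ) < k := h
    omega
  rw [h4] at h2
  zify
  nlinarith [Int.natCast_nonneg (r : ℕ)]

theorem coeff_hypForm (j k : Fin n) (c : (Fin n × Fin n) ⊕ (Fin n × Fin n) →₀ ℕ) :
    (hypForm K n j k).coeff c =
      ∑ r, ((if hypExp j k r = c then (1 : K) else 0) +
        if hypExp k j r = c then (1 : K) else 0) := by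
  classical
  rw [hypForm, coeff_sum]
  refine Finset.sum_congr rfl fun r _ => ?_
  rw [mul_comm (X (Sum.inr (r, j)))]
  simp only [X, monomial_mul, coeff_add, coeff_monomial, hypExp, mul_one]
  congr!

variable {K}

theorem coeff_hypForm_ne_zero (h2 : (2 : K) ≠ 0) {j k r : Fin n} (hjk : (j : ℕ) + r = k) :
    (hypForm K n j k).coeff (hypExp j k r) ≠ 0 := by
  have e1 : ∀ r', hypExp j k r' = hypExp j k r ↔ r' = r := by
    refine fun r' => ⟨fun h => ?_, fun h => by rw [h]⟩
    by_contra hne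
    have := weight_hypExp_lt (j := j) (k := k) (r := r') (by
      intro h'; exact hne (Fin.ext (by omega))) hjk
    rw [h] at this
    exact lt_irrefl _ this
  rw [coeff_hypForm, Finset.sum_add_distrib]
  simp only [e1, Finset.sum_ite_eq', Finset.mem_univ, if_true]
  -- On the diagonal both summands contribute the same monomial and the coefficient is 2; off the
  -- diagonal it is 1.
  by_cases hj : j = k
  · subst hj
    simp only [e1, Finset.sum_ite_eq', Finset.mem_univ, if_true]
    rwa [one_add_one_eq_two]
  · have e2 : ∀ r', hypExp k j r' ≠ hypExp j k r := by
      intro r' h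
      have := weight_hypExp_swap_lt (j := j) (k := k)
        (lt_of_le_of_ne (Fin.le_def.2 (by omega)) hj) r' hjk
      rw [h] at this
      exact lt_irrefl _ this
    simp [e2]

theorem weight_lt_of_mem_support_hypForm {j k r : Fin n} (hjk : (j : ℕ) + r = k)
    {c : (Fin n × Fin n) ⊕ (Fin n × Fin n) →₀ ℕ} (hcs : c ∈ (hypForm K n j k).support)
    (hne : c ≠ hypExp j k r) :
    Finsupp.weight (hypWeight n) c < Finsupp.weight (hypWeight n) (hypExp j k r) := by
  rw [mem_support_iff, coeff_hypForm] at hcs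
  obtain ⟨r', -, hr'⟩ := Finset.exists_ne_zero_of_sum_ne_zero hcs
  have : hypExp j k r' = c ∨ hypExp k j r' = c := by
    by_contra hcon
    rw [not_or] at hcon
    simp [hcon.1, hcon.2] at hr'
  have key : hypExp j k r' = c → Finsupp.weight (hypWeight n) c <
      Finsupp.weight (hypWeight n) (hypExp j k r) := by
    intro h3
    rw [← h3] at hne ⊢
    refine weight_hypExp_lt (fun h' => hne ?_) hjk
    rw [show r' = r from Fin.ext (by omega)]
  by_cases hj : j = k
  · subst hj
    exact key (by simpa using this)
  rcases this with h3 | h3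
  · exact key h3
  · rw [← h3]
    exact weight_hypExp_swap_lt (lt_of_le_of_ne (Fin.le_def.2 (by omega)) hj) r' hjk

theorem isRadical_span_hypForm (h2 : (2 : K) ≠ 0) :
    (Ideal.span {p | ∃ j k : Fin n, p = hypForm K n j k}).IsRadical := by
  let f : {q : Fin n × Fin n // (q.1 : ℕ) ≤ q.2} → MvPolynomial _ K :=
    fun q => hypForm K n q.1.1 q.1.2
  have hspan : {p | ∃ j k : Fin n, p = hypForm K n j k} = Set.range f := by
    ext p
    constructor
    · rintro ⟨j, k, rfl⟩
      rcases le_total (j : ℕ) k with h | h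
      · exact ⟨⟨(j, k), h⟩, rfl⟩
      · refine ⟨⟨(k, j), h⟩, ?_⟩
        refine Finset.sum_congr rfl fun r _ => ?_
        dsimp only
        ring
    · rintro ⟨q, rfl⟩
      exact ⟨_, _, rfl⟩
  rw [hspan]
  have hr : ∀ q : {q : Fin n × Fin n // (q.1 : ℕ) ≤ q.2}, (q.1.1 : ℕ) + (q.1.2 - q.1.1) = q.1.2 :=
    fun q => Nat.add_sub_cancel' q.2
  refine isRadical_span_of_weight (hypWeight n) f
    (fun q => hypExp q.1.1 q.1.2 ⟨q.1.2 - q.1.1, by omega⟩)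
    (fun q => coeff_hypForm_ne_zero h2 (hr q))
    (fun q c => weight_lt_of_mem_support_hypForm (hr q)) ?_ ?_
  -- The leading monomial is a_{k-j,j} b_{k-j,k}. Row plus column of its a-variable gives k, and
  -- column minus row of its b-variable gives j, so either variable determines the pair.
  · rintro ⟨⟨j, k⟩, h⟩ ⟨⟨j', k'⟩, h'⟩ hne v
    by_contra hcon
    rw [not_or] at hcon
    apply hne
    obtain ⟨h1, h2⟩ := hcon
    rcases v with ⟨r, l⟩ | ⟨r, l⟩ <;>
      simp [hypExp, Finsupp.single_apply, Fin.ext_iff] at h1 h2 h h' ⊢ <;> omega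
  · rintro ⟨⟨j, k⟩, h⟩ v
    rcases v with ⟨r, l⟩ | ⟨r, l⟩ <;>
      simp [hypExp, Finsupp.single_apply] <;> split_ifs <;> omega

end Hyperbolic

end SymmetricNullcone

namespace SymmetricNullcone

open MvPolynomial

/-! ### The change of coordinates and radicality of the Gram ideal -/

section Radical

variable {K : Type*} [Field K] {n d : ℕ}

/-- Splitting the rows of a matrix with `n + n` rows into an upper and a lower half. -/
def rowEquiv (h : d = n + n) : Fin d ≃ Fin n ⊕ Fin n :=
  (finCongr h).trans finSumFinEquiv.symm

/-- The change of coordinates that turns `Yᵗ Y` into `2 (Aᵗ B + Bᵗ A)`. -/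
def toHyp (i : K) (h : d = n + n) :
    PolyRing K d n →ₐ[K] MvPolynomial ((Fin n × Fin n) ⊕ (Fin n × Fin n)) K :=
  aeval fun v => Sum.elim (fun s => X (Sum.inl (s, v.2)) + X (Sum.inr (s, v.2)))
    (fun s => C i * (X (Sum.inl (s, v.2)) - X (Sum.inr (s, v.2)))) (rowEquiv h v.1)

/-- The inverse of `toHyp`. -/
def ofHyp (i : K) (h : d = n + n) :
    MvPolynomial ((Fin n × Fin n) ⊕ (Fin n × Fin n)) K →ₐ[K] PolyRing K d n :=
  aeval (Sum.elim
    (fun v => C (2⁻¹ : K) * (X ((rowEquiv h).symm (Sum.inl v.1), v.2) -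
      C i * X ((rowEquiv h).symm (Sum.inr v.1), v.2)))
    (fun v => C (2⁻¹ : K) * (X ((rowEquiv h).symm (Sum.inl v.1), v.2) +
      C i * X ((rowEquiv h).symm (Sum.inr v.1), v.2))))

theorem C_half (K σ : Type*) [Field K] (h2 : (2 : K) ≠ 0) :
    (C (2⁻¹ : K) : MvPolynomial σ K) * 2 = 1 := by
  rw [show (2 : MvPolynomial σ K) = C 2 from (map_ofNat C 2).symm, ← C_mul, inv_mul_cancel₀ h2, C_1]

theorem C_sq_eq (σ : Type*) {i : K} (hi : i ^ 2 = -1) :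
    (C i : MvPolynomial σ K) * C i = -1 := by
  rw [← C_mul, ← sq, hi, C_neg, C_1]

/-- The change of coordinates that turns `Yᵗ Y` into `2 (Aᵗ B + Bᵗ A)`, as an isomorphism. -/
def hypEquiv (h2 : (2 : K) ≠ 0) {i : K} (hi : i ^ 2 = -1) (h : d = n + n) :
    PolyRing K d n ≃ₐ[K] MvPolynomial ((Fin n × Fin n) ⊕ (Fin n × Fin n)) K :=
  AlgEquiv.ofAlgHom (toHyp i h) (ofHyp i h)
    (by
      ext1 v
      have e1 := C_half K ((Fin n × Fin n) ⊕ (Fin n × Fin n)) h2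
      have e2 := C_sq_eq ((Fin n × Fin n) ⊕ (Fin n × Fin n)) hi
      rcases v with ⟨s, j⟩ | ⟨s, j⟩
      · simp [toHyp, ofHyp]
        linear_combination (X (Sum.inl (s, j))) * e1 -
          C (2⁻¹ : K) * (X (Sum.inl (s, j)) - X (Sum.inr (s, j))) * e2
      · simp [toHyp, ofHyp]
        linear_combination (X (Sum.inr (s, j))) * e1 +
          C (2⁻¹ : K) * (X (Sum.inl (s, j)) - X (Sum.inr (s, j))) * e2)
    (by
      ext1 ⟨r, j⟩
      have e1 := C_half K (Fin d × Fin n) h2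
      have e2 := C_sq_eq (Fin d × Fin n) hi
      obtain ⟨s, rfl⟩ := (rowEquiv h).symm.surjective r
      rcases s with s | s
      · simp [toHyp, ofHyp]
        linear_combination (X ((rowEquiv h).symm (Sum.inl s), j)) * e1
      · simp [toHyp, ofHyp]
        linear_combination (X ((rowEquiv h).symm (Sum.inr s), j)) * e1 -
          C (2⁻¹ : K) * 2 * (X ((rowEquiv h).symm (Sum.inr s), j)) * e2)

/-- Pairing row s with row n + s reduces this to (a + b)(a' + b') + i²(a - b)(a' - b') = 2(ab' +
ba'). -/
theorem toHyp_gram {i : K} (hi : i ^ 2 = -1) (h : d = n + n) (j k : Fin n) :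
    toHyp i h (((genMatrix K d n).transpose * genMatrix K d n) j k) = 2 * hypForm K n j k := by
  have e2 := C_sq_eq ((Fin n × Fin n) ⊕ (Fin n × Fin n)) hi
  rw [Matrix.mul_apply, map_sum, ← (rowEquiv h).symm.sum_comp, Fintype.sum_sum_type,
    ← Finset.sum_add_distrib, hypForm, Finset.mul_sum]
  refine Finset.sum_congr rfl fun s _ => ?_
  simp [toHyp, Matrix.mvPolynomialX_apply]
  linear_combination (X (Sum.inl (s, j)) - X (Sum.inr (s, j))) *
    (X (Sum.inl (s, k)) - X (Sum.inr (s, k))) * e2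

theorem isRadical_gramIdeal (h2 : (2 : K) ≠ 0) {i : K} (hi : i ^ 2 = -1) (h : d = n + n) :
    (gramIdeal K d n).IsRadical := by
  let φ := hypEquiv h2 hi h
  have hmap : (gramIdeal K d n).map φ = Ideal.span {p | ∃ j k : Fin n, p = hypForm K n j k} := by
    rw [gramIdeal, Ideal.map_span]
    have e1 := C_half K ((Fin n × Fin n) ⊕ (Fin n × Fin n)) h2
    apply le_antisymm <;> rw [Ideal.span_le]
    · rintro _ ⟨_, ⟨j, k, rfl⟩, rfl⟩
      change toHyp i h _ ∈ _
      rw [toHyp_gram hi h]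
      exact Ideal.mul_mem_left _ _ (Ideal.subset_span ⟨j, k, rfl⟩)
    · rintro _ ⟨j, k, rfl⟩
      have : hypForm K n j k = C (2⁻¹ : K) *
          φ (((genMatrix K d n).transpose * genMatrix K d n) j k) := by
        change _ = _ * toHyp i h _
        rw [toHyp_gram hi h]
        linear_combination -hypForm K n j k * e1
      rw [this]
      exact Ideal.mul_mem_left _ _ (Ideal.subset_span ⟨_, ⟨j, k, rfl⟩, rfl⟩)
  have hrad := isRadical_span_hypForm (K := K) (n := n) h2
  rw [← hmap] at hrad
  have := hrad.comap φ
  rwa [Ideal.comap_map_of_bijective φ φ.bijective] at this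

end Radical

end SymmetricNullcone

namespace SymmetricNullcone

open Matrix Module

/-! ### Orthogonal complements and isotropic subspaces -/

section Perp

variable {K ι : Type*} [Field K] [Fintype ι]

/-- The standard symmetric bilinear form on `K^ι`. -/
def dotForm (K ι : Type*) [Field K] [Fintype ι] : LinearMap.BilinForm K (ι → K) :=
  dotProductBilin K K

theorem dotForm_apply (x y : ι → K) : dotForm K ι x y = x ⬝ᵥ y := rfl

theorem dotForm_isRefl : (dotForm K ι).IsRefl := fun x y h => by
  rw [dotForm_apply] at h ⊢
  rw [dotProduct_comm, h]

theorem dotForm_nondegenerate : (dotForm K ι).Nondegenerate := by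
  refine ⟨fun x h => dotProduct_eq_zero x h, fun x h => dotProduct_eq_zero x fun y => ?_⟩
  rw [dotProduct_comm]
  exact h y

/-- The orthogonal complement for the standard symmetric bilinear form. -/
def perp (T : Submodule K (ι → K)) : Submodule K (ι → K) := (dotForm K ι).orthogonal T

theorem finrank_perp (T : Submodule K (ι → K)) :
    finrank K (perp T) = Fintype.card ι - finrank K T := by
  rw [perp, LinearMap.BilinForm.finrank_orthogonal dotForm_nondegenerate,
    finrank_fintype_fun_eq_card]

theorem perp_perp (T : Submodule K (ι → K)) : perp (perp T) = T :=
  LinearMap.BilinForm.orthogonal_orthogonal dotForm_nondegenerate dotForm_isRefl T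

theorem perp_anti {S T : Submodule K (ι → K)} (h : S ≤ T) : perp T ≤ perp S :=
  fun _ hx t ht => hx t (h ht)

theorem mem_perp_span {s : Set (ι → K)} {x : ι → K} :
    x ∈ perp (Submodule.span K s) ↔ ∀ t ∈ s, t ⬝ᵥ x = 0 := by
  refine ⟨fun h t ht => h t (Submodule.subset_span ht), fun h t ht => ?_⟩
  induction ht using Submodule.span_induction with
  | mem t ht => exact h t ht
  | zero => simp
  | add a b _ _ ha hb => rw [map_add, LinearMap.add_apply, ha, hb, add_zero]
  | smul c a _ ha => rw [map_smul, LinearMap.smul_apply, ha, smul_zero]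

theorem mem_perp_sup {S T : Submodule K (ι → K)} {x : ι → K} :
    x ∈ perp (S ⊔ T) ↔ x ∈ perp S ∧ x ∈ perp T := by
  refine ⟨fun h => ⟨perp_anti le_sup_left h, perp_anti le_sup_right h⟩, fun h t ht => ?_⟩
  obtain ⟨a, ha, b, hb, rfl⟩ := Submodule.mem_sup.1 ht
  rw [map_add, LinearMap.add_apply, h.1 a ha, h.2 b hb, add_zero]

theorem perp_bot : perp (⊥ : Submodule K (ι → K)) = ⊤ := by
  rw [perp, LinearMap.BilinForm.orthogonal_bot]

/-- A subspace consisting of isotropic vectors is totally isotropic. -/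
theorem dotProduct_eq_zero_of_isotropic (h2 : (2 : K) ≠ 0) {W : Submodule K (ι → K)}
    (h : ∀ x ∈ W, x ⬝ᵥ x = 0) {x y : ι → K} (hx : x ∈ W) (hy : y ∈ W) : x ⬝ᵥ y = 0 := by
  have := h _ (W.add_mem hx hy)
  rw [dotProduct_add, add_dotProduct, add_dotProduct, h x hx, h y hy, dotProduct_comm y x] at this
  apply (mul_eq_zero.1 _).resolve_left h2
  linear_combination this

/-- By polarization, a complement made of isotropic vectors would be orthogonal to itself, hence
contained in T^⊥⊥ = T. -/
theorem exists_mem_perp_not_isotropic (h2 : (2 : K) ≠ 0) (T : Submodule K (ι → K))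
    (hT : ¬ perp T ≤ T) : ∃ w ∈ perp T, w ⬝ᵥ w ≠ 0 := by
  by_contra! h
  apply hT
  intro x hx
  rw [← perp_perp T]
  exact fun t ht => dotProduct_eq_zero_of_isotropic h2 h ht hx

theorem exists_mem_perp_not_isotropic_of_finrank (h2 : (2 : K) ≠ 0) (T : Submodule K (ι → K))
    (hT : 2 * finrank K T < Fintype.card ι) : ∃ w ∈ perp T, w ⬝ᵥ w ≠ 0 := by
  apply exists_mem_perp_not_isotropic h2
  intro h
  have := Submodule.finrank_mono h
  rw [finrank_perp] at this
  omega

/-- This covers the borderline dimension: if T^⊥ were isotropic, then T^⊥ ⊆ T would be an equality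
by dimension, which e contradicts. -/
theorem exists_mem_perp_not_isotropic_of_mem (h2 : (2 : K) ≠ 0) (T : Submodule K (ι → K))
    (hT : 2 * finrank K T ≤ Fintype.card ι) {e : ι → K} (he : e ∈ T) (hee : e ⬝ᵥ e ≠ 0) :
    ∃ w ∈ perp T, w ⬝ᵥ w ≠ 0 := by
  by_contra! h
  have h1 : perp T ≤ T := by
    by_contra hcon
    obtain ⟨w, hw, hw'⟩ := exists_mem_perp_not_isotropic h2 T hcon
    exact hw' (h w hw)
  have h3 : perp T = T := by
    apply Submodule.eq_of_le_of_finrank_le h1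
    rw [finrank_perp]
    omega
  exact hee (h e (by rw [h3]; exact he))

/-- For y, z in W independent modulo E, isotropy of y + tz is a quadratic equation in t, solvable
over K unless z is itself isotropic; y + tz never lies in E. -/
theorem exists_isotropic_notMem [IsAlgClosed K] (h2 : (2 : K) ≠ 0) {E W : Submodule K (ι → K)}
    (h : finrank K E + 2 ≤ finrank K W) : ∃ x ∈ W, x ⬝ᵥ x = 0 ∧ x ∉ E := by
  have key : ∀ F : Submodule K (ι → K), finrank K F < finrank K W → ∃ x ∈ W, x ∉ F := by
    intro F hF
    by_contra! hcon
    exact absurd (Submodule.finrank_mono (show W ≤ F from hcon)) (by omega)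
  obtain ⟨y, hyW, hyE⟩ := key E (by omega)
  have hspan : finrank K (Submodule.span K {y}) ≤ 1 := (finrank_span_le_card {y}).trans (by simp)
  obtain ⟨z, hzW, hzE⟩ := key (E ⊔ Submodule.span K {y}) (by
    have := Submodule.finrank_add_le_finrank_add_finrank E (Submodule.span K {y})
    omega)
  by_cases hz : z ⬝ᵥ z = 0
  · exact ⟨z, hzW, hz, fun h => hzE (Submodule.mem_sup_left h)⟩
  have : NeZero (2 : K) := ⟨h2⟩
  obtain ⟨t, ht⟩ := exists_quadratic_eq_zero (a := z ⬝ᵥ z) (b := 2 * (y ⬝ᵥ z)) (c := y ⬝ᵥ y) hz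
    (IsAlgClosed.exists_eq_mul_self _)
  refine ⟨y + t • z, W.add_mem hyW (W.smul_mem t hzW), ?_, fun hmem => ?_⟩
  · simp only [dotProduct_add, add_dotProduct, smul_dotProduct, dotProduct_smul, smul_eq_mul,
      dotProduct_comm z y]
    linear_combination ht
  · by_cases ht0 : t = 0
    · rw [ht0, zero_smul, add_zero] at hmem
      exact hyE hmem
    · apply hzE
      have h1 : z = t⁻¹ • ((y + t • z) - y) := by
        rw [add_sub_cancel_left, smul_smul, inv_mul_cancel₀ ht0, one_smul]
      rw [h1]
      exact Submodule.smul_mem _ _ (Submodule.sub_mem _ (Submodule.mem_sup_left hmem)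
        (Submodule.mem_sup_right (Submodule.mem_span_singleton_self y)))

/-- Totally isotropic subspaces orthogonal to `D` can be enlarged up to the expected dimension. -/
theorem exists_isotropic_ge [IsAlgClosed K] (h2 : (2 : K) ≠ 0) (D : Submodule K (ι → K)) (k : ℕ)
    (hk : 2 * k + finrank K D ≤ Fintype.card ι) (E : Submodule K (ι → K)) (hED : E ≤ perp D)
    (hE : ∀ x ∈ E, x ⬝ᵥ x = 0) (hEk : finrank K E ≤ k) :
    ∃ E', E ≤ E' ∧ E' ≤ perp D ∧ (∀ x ∈ E', x ⬝ᵥ x = 0) ∧ finrank K E' = k := by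
  obtain ⟨c, hc⟩ : ∃ c, c = k - finrank K E := ⟨_, rfl⟩
  induction c generalizing E with
  | zero => exact ⟨E, le_rfl, hED, hE, by omega⟩
  | succ c ih =>
    -- While dim E < k, the complement of E + D has dimension at least 2k - dim E ≥ dim E + 2.
    obtain ⟨x, hxW, hx, hxE⟩ := exists_isotropic_notMem h2 (E := E) (W := perp (E ⊔ D)) (by
      rw [finrank_perp]
      have := Submodule.finrank_add_le_finrank_add_finrank E D
      omega)
    rw [mem_perp_sup] at hxW
    have hfin : finrank K (E ⊔ Submodule.span K {x} : Submodule K (ι → K)) = finrank K E + 1 := by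
      have h1 := Submodule.finrank_add_le_finrank_add_finrank E (Submodule.span K {x})
      have h3 : finrank K (Submodule.span K {x}) ≤ 1 := (finrank_span_le_card {x}).trans (by simp)
      have h4 : E < E ⊔ Submodule.span K {x} := by
        refine lt_of_le_of_ne le_sup_left fun h => hxE ?_
        rw [h]
        exact Submodule.mem_sup_right (Submodule.mem_span_singleton_self x)
      have h5 := Submodule.finrank_lt_finrank_of_lt h4
      omega
    obtain ⟨E', h3, h4⟩ := ih (E ⊔ Submodule.span K {x})
      (sup_le hED (by rw [Submodule.span_singleton_le_iff_mem]; exact hxW.2))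
      (by
        intro y hy
        obtain ⟨a, ha, b, hb, rfl⟩ := Submodule.mem_sup.1 hy
        obtain ⟨t, rfl⟩ := Submodule.mem_span_singleton.1 hb
        have h1 : a ⬝ᵥ x = 0 := hxW.1 a ha
        simp [dotProduct_comm x a, hE a ha, hx, h1])
      (by omega) (by omega)
    exact ⟨E', le_sup_left.trans h3, h4⟩

theorem exists_between_finrank {V : Type*} [AddCommGroup V] [Module K V] [FiniteDimensional K V]
    {A B : Submodule K V} (hAB : A ≤ B) {k : ℕ} (hA : finrank K A ≤ k) (hB : k ≤ finrank K B) :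
    ∃ F, A ≤ F ∧ F ≤ B ∧ finrank K F = k := by
  obtain ⟨c, hc⟩ : ∃ c, c = k - finrank K A := ⟨_, rfl⟩
  induction c generalizing A with
  | zero => exact ⟨A, le_rfl, hAB, by omega⟩
  | succ c ih =>
    obtain ⟨x, hxB, hxA⟩ : ∃ x ∈ B, x ∉ A := by
      by_contra! hcon
      exact absurd (Submodule.finrank_mono (show B ≤ A from hcon)) (by omega)
    have h1 := Submodule.finrank_add_le_finrank_add_finrank A (Submodule.span K {x})
    have h3 : finrank K (Submodule.span K {x}) ≤ 1 := (finrank_span_le_card {x}).trans (by simp)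
    have h4 : A < A ⊔ Submodule.span K {x} := by
      refine lt_of_le_of_ne le_sup_left fun h => hxA ?_
      rw [h]
      exact Submodule.mem_sup_right (Submodule.mem_span_singleton_self x)
    have h5 := Submodule.finrank_lt_finrank_of_lt h4
    obtain ⟨F, h6, h7⟩ := ih (A := A ⊔ Submodule.span K {x})
      (sup_le hAB (by rwa [Submodule.span_singleton_le_iff_mem])) (by omega) (by omega)
    exact ⟨F, le_sup_left.trans h6, h7⟩

end Perp

/-! ### Reflections and their even products -/

section Reflection

variable {K ι : Type*} [Field K] [Fintype ι] [DecidableEq ι]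

/-- The reflection in the hyperplane orthogonal to `u`. -/
def reflection (u : ι → K) : Matrix ι ι K := 1 - (2 / (u ⬝ᵥ u)) • vecMulVec u u

theorem reflection_mulVec (u x : ι → K) :
    reflection u *ᵥ x = x - (2 / (u ⬝ᵥ u) * (u ⬝ᵥ x)) • u := by
  rw [reflection, sub_mulVec, one_mulVec, smul_mulVec, vecMulVec_mulVec]
  ext r
  simp only [Pi.sub_apply, Pi.smul_apply, smul_eq_mul, MulOpposite.smul_eq_mul_unop,
    MulOpposite.unop_op]
  ring

theorem reflection_transpose (u : ι → K) : (reflection u)ᵀ = reflection u := by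
  rw [reflection, transpose_sub, transpose_one, transpose_smul, transpose_vecMulVec]

theorem reflection_mulVec_of_perp {u x : ι → K} (h : u ⬝ᵥ x = 0) : reflection u *ᵥ x = x := by
  rw [reflection_mulVec, h, mul_zero, zero_smul, sub_zero]

/-- No condition on u is needed: for isotropic u, division by zero makes `reflection u` the
identity. -/
theorem reflection_mul_self (u : ι → K) : reflection u * reflection u = 1 := by
  apply Matrix.ext_of_mulVec_single
  intro j
  rw [one_mulVec, ← mulVec_mulVec, reflection_mulVec, reflection_mulVec]
  by_cases h : u ⬝ᵥ u = 0
  · simp [h]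
  · rw [dotProduct_sub, dotProduct_smul, sub_sub, ← add_smul, sub_eq_self]
    have : (2 / u ⬝ᵥ u * u ⬝ᵥ Pi.single j 1 + 2 / u ⬝ᵥ u *
      (u ⬝ᵥ Pi.single j 1 - (2 / u ⬝ᵥ u * u ⬝ᵥ Pi.single j 1) • (u ⬝ᵥ u))) = 0 := by
      rw [smul_eq_mul]
      field_simp
      ring
    rw [this, zero_smul]

theorem det_reflection {u : ι → K} (hu : u ⬝ᵥ u ≠ 0) : (reflection u).det = -1 := by
  have h : reflection u = 1 + replicateCol Unit (-(2 / (u ⬝ᵥ u)) • u) * replicateRow Unit u := by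
    rw [reflection]
    ext a b
    simp [vecMulVec_apply, Matrix.mul_apply, sub_eq_add_neg, mul_assoc]
  rw [h, det_one_add_replicateCol_mul_replicateRow, dotProduct_smul, smul_eq_mul]
  field_simp
  ring

/-- Products of an even number of reflections in nonisotropic vectors orthogonal to `T`. -/
def evenGroup (T : Submodule K (ι → K)) : Submonoid (Matrix ι ι K) :=
  Submonoid.closure {g | ∃ u ∈ perp T, ∃ v ∈ perp T, u ⬝ᵥ u ≠ 0 ∧ v ⬝ᵥ v ≠ 0 ∧
    g = reflection u * reflection v}

theorem mul_reflection_mem {T : Submodule K (ι → K)} {u v : ι → K} (hu : u ∈ perp T)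
    (hv : v ∈ perp T) (huu : u ⬝ᵥ u ≠ 0) (hvv : v ⬝ᵥ v ≠ 0) :
    reflection u * reflection v ∈ evenGroup T :=
  Submonoid.subset_closure ⟨u, hu, v, hv, huu, hvv, rfl⟩

theorem evenGroup_anti {S T : Submodule K (ι → K)} (h : S ≤ T) : evenGroup T ≤ evenGroup S := by
  apply Submonoid.closure_mono
  rintro _ ⟨u, hu, v, hv, h1⟩
  exact ⟨u, perp_anti h hu, v, perp_anti h hv, h1⟩

theorem transpose_mul_of_mem_evenGroup {T : Submodule K (ι → K)} {g : Matrix ι ι K}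
    (hg : g ∈ evenGroup T) : gᵀ * g = 1 := by
  induction hg using Submonoid.closure_induction with
  | mem g hg =>
    obtain ⟨u, -, v, -, -, -, rfl⟩ := hg
    rw [transpose_mul, reflection_transpose, reflection_transpose, Matrix.mul_assoc,
      ← Matrix.mul_assoc (reflection u), reflection_mul_self, Matrix.one_mul, reflection_mul_self]
  | one => simp
  | mul a b _ _ ha hb =>
    rw [transpose_mul, Matrix.mul_assoc, ← Matrix.mul_assoc aᵀ, ha, Matrix.one_mul, hb]

theorem det_of_mem_evenGroup {T : Submodule K (ι → K)} {g : Matrix ι ι K}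
    (hg : g ∈ evenGroup T) : g.det = 1 := by
  induction hg using Submonoid.closure_induction with
  | mem g hg =>
    obtain ⟨u, -, v, -, hu, hv, rfl⟩ := hg
    rw [det_mul, det_reflection hu, det_reflection hv]
    norm_num
  | one => simp
  | mul a b _ _ ha hb => rw [det_mul, ha, hb, one_mul]

theorem mulVec_of_mem_evenGroup {T : Submodule K (ι → K)} {g : Matrix ι ι K}
    (hg : g ∈ evenGroup T) {t : ι → K} (ht : t ∈ T) : g *ᵥ t = t := by
  induction hg using Submonoid.closure_induction with
  | mem g hg =>
    obtain ⟨u, hu, v, hv, -, -, rfl⟩ := hg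
    have h1 : v ⬝ᵥ t = 0 := (dotProduct_comm v t).trans (hv t ht)
    have h2 : u ⬝ᵥ t = 0 := (dotProduct_comm u t).trans (hu t ht)
    rw [← mulVec_mulVec, reflection_mulVec_of_perp h1, reflection_mulVec_of_perp h2]
  | one => simp
  | mul a b _ _ ha hb => rw [← mulVec_mulVec, hb, ha]

theorem dotProduct_mulVec_of_mem_evenGroup {T : Submodule K (ι → K)} {g : Matrix ι ι K}
    (hg : g ∈ evenGroup T) (x y : ι → K) : (g *ᵥ x) ⬝ᵥ (g *ᵥ y) = x ⬝ᵥ y := by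
  rw [dotProduct_mulVec, vecMul_mulVec, transpose_mul_of_mem_evenGroup hg, vecMul_one]

theorem reflection_sub_mulVec {x f : ι → K} (hx : x ⬝ᵥ x = 0) (hf : f ⬝ᵥ f = 0)
    (hxf : x ⬝ᵥ f ≠ 0) (h2 : (2 : K) ≠ 0) :
    (x - f) ⬝ᵥ (x - f) ≠ 0 ∧ reflection (x - f) *ᵥ f = x := by
  have h1 : (x - f) ⬝ᵥ (x - f) = -2 * (x ⬝ᵥ f) := by
    rw [dotProduct_sub, sub_dotProduct, sub_dotProduct, hx, hf, dotProduct_comm f x]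
    ring
  have h3 : (x - f) ⬝ᵥ f = x ⬝ᵥ f := by rw [sub_dotProduct, hf, sub_zero]
  refine ⟨by rw [h1]; simp [h2, hxf], ?_⟩
  rw [reflection_mulVec, h1, h3]
  have : 2 / (-2 * x ⬝ᵥ f) * x ⬝ᵥ f = -1 := by field_simp
  rw [this, neg_one_smul, sub_neg_eq_add, add_sub_cancel]

/-- Two isotropic vectors orthogonal to `T` are related by reflections that fix `T`. -/
theorem exists_evenGroup_mulVec_eq (h2 : (2 : K) ≠ 0) {T : Submodule K (ι → K)} {x f : ι → K}
    (hxT : x ∈ perp T) (hfT : f ∈ perp T) (hx : x ⬝ᵥ x = 0) (hf : f ⬝ᵥ f = 0) (hx' : x ∉ T)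
    (hf' : f ∉ T) (hw : ∃ w ∈ perp (T ⊔ Submodule.span K {f}), w ⬝ᵥ w ≠ 0) :
    ∃ g ∈ evenGroup T, g *ᵥ f = x := by
  -- Orthogonal x and f are joined by two reflections through an isotropic y orthogonal to neither.
  -- Otherwise one reflection moves f to x, and a reflection fixing f restores parity.
  by_cases hxf : x ⬝ᵥ f = 0
  · have hex : ∀ y ∉ T, ∃ z ∈ perp T, z ⬝ᵥ y ≠ 0 := by
      intro y hy
      by_contra! hcon
      exact hy (by rw [← perp_perp T]; exact hcon)
    obtain ⟨z, hz, hzx, hzf⟩ : ∃ z ∈ perp T, z ⬝ᵥ x ≠ 0 ∧ z ⬝ᵥ f ≠ 0 := by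
      obtain ⟨z₁, h1, h1x⟩ := hex x hx'
      obtain ⟨z₂, h3, h3f⟩ := hex f hf'
      by_cases h4 : z₁ ⬝ᵥ f = 0
      · by_cases h5 : z₂ ⬝ᵥ x = 0
        · exact ⟨z₁ + z₂, Submodule.add_mem _ h1 h3, by
            rw [add_dotProduct, h5, add_zero]; exact h1x,
            by rw [add_dotProduct, h4, zero_add]; exact h3f⟩
        · exact ⟨z₂, h3, h5, h3f⟩
      · exact ⟨z₁, h1, h1x, h4⟩
    -- The coefficient makes y isotropic; subtracting a multiple of x leaves the products with x and
    -- f unchanged.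
    let y := z - (z ⬝ᵥ z / (2 * (z ⬝ᵥ x))) • x
    have hyT : y ∈ perp T := Submodule.sub_mem _ hz (Submodule.smul_mem _ _ hxT)
    have hyy : y ⬝ᵥ y = 0 := by
      simp only [y, dotProduct_sub, sub_dotProduct, smul_dotProduct, dotProduct_smul, smul_eq_mul,
        hx, dotProduct_comm x z]
      field_simp
      ring
    have hyx : y ⬝ᵥ x ≠ 0 := by simpa [y, sub_dotProduct, hx] using hzx
    have hyf : y ⬝ᵥ f ≠ 0 := by simpa [y, sub_dotProduct, hxf] using hzf
    obtain ⟨h3, h4⟩ := reflection_sub_mulVec hyy hf hyf h2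
    obtain ⟨h5, h6⟩ := reflection_sub_mulVec hx hyy (by rwa [dotProduct_comm]) h2
    refine ⟨_, mul_reflection_mem (Submodule.sub_mem _ hxT hyT) (Submodule.sub_mem _ hyT hfT) h5 h3,
      ?_⟩
    rw [← mulVec_mulVec, h4, h6]
  · obtain ⟨w, hw, hww⟩ := hw
    rw [mem_perp_sup] at hw
    obtain ⟨h3, h4⟩ := reflection_sub_mulVec hx hf hxf h2
    refine ⟨_, mul_reflection_mem (Submodule.sub_mem _ hxT hfT) hw.1 h3 hww, ?_⟩
    have h5 : w ⬝ᵥ f = 0 :=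
      (dotProduct_comm w f).trans (hw.2 f (Submodule.mem_span_singleton_self f))
    rw [← mulVec_mulVec, reflection_mulVec_of_perp h5, h4]

end Reflection

end SymmetricNullcone

namespace SymmetricNullcone

open Matrix Module

/-! ### Transitivity on isotropic frames -/

section Frames

variable {K ι : Type*} [Field K] [Fintype ι]

/-- A linearly independent family of mutually orthogonal isotropic vectors orthogonal to `e`. -/
structure IsFrame {m : ℕ} (e : ι → K) (f : Fin m → ι → K) : Prop where
  linearIndependent : LinearIndependent K f
  dotProduct_eq_zero : ∀ j k, f j ⬝ᵥ f k = 0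
  dotProduct_left : ∀ j, e ⬝ᵥ f j = 0

theorem IsFrame.mem_perp_span_range {m : ℕ} {e : ι → K} {f : Fin m → ι → K} (hf : IsFrame e f)
    (j : Fin m) : f j ∈ perp (Submodule.span K (Set.range f)) := by
  rw [mem_perp_span]
  rintro _ ⟨k, rfl⟩
  exact hf.dotProduct_eq_zero k j

/-- Pairing with the non-isotropic e kills the e-component, after which linear independence applies.
-/
theorem IsFrame.notMem_sup {m : ℕ} {e : ι → K} (he : e ⬝ᵥ e ≠ 0) {f : Fin m → ι → K}
    (hf : IsFrame e f) (r : Fin m) :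
    f r ∉ Submodule.span K {e} ⊔ Submodule.span K (f '' {j | j < r}) := by
  intro h
  obtain ⟨a, ha, y, hy, hay⟩ := Submodule.mem_sup.1 h
  obtain ⟨c, rfl⟩ := Submodule.mem_span_singleton.1 ha
  have hey : e ⬝ᵥ y = 0 := by
    have : Submodule.span K (f '' {j | j < r}) ≤ perp (Submodule.span K {e}) := by
      rw [Submodule.span_le]
      rintro _ ⟨j, -, rfl⟩
      rw [SetLike.mem_coe, mem_perp_span]
      rintro _ rfl
      exact hf.dotProduct_left j
    exact this hy e (Submodule.mem_span_singleton_self e)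
  have h1 := hf.dotProduct_left r
  rw [← hay, dotProduct_add, dotProduct_smul, hey, add_zero, smul_eq_mul] at h1
  rw [(mul_eq_zero.1 h1).resolve_right he, zero_smul, zero_add] at hay
  exact hf.linearIndependent.notMem_span_image (s := {j | j < r}) (x := r) (by simp) (hay ▸ hy)

theorem exists_isFrame [IsAlgClosed K] (h2 : (2 : K) ≠ 0) {m : ℕ}
    (hm : 2 * (m + 1) ≤ Fintype.card ι)
    (e : ι → K) : ∃ f : Fin m → ι → K, IsFrame e f := by
  obtain ⟨E, -, hE1, hE2, hE3⟩ := exists_isotropic_ge h2 (Submodule.span K {e}) m (by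
    have h3 : finrank K (Submodule.span K {e}) ≤ 1 := (finrank_span_le_card {e}).trans (by simp)
    omega) ⊥ bot_le (by simp) (by simp)
  let b := finBasisOfFinrankEq K E hE3
  refine ⟨fun j => b j, b.linearIndependent.map' E.subtype E.ker_subtype, fun j k =>
    dotProduct_eq_zero_of_isotropic h2 hE2 (b j).2 (b k).2, fun j =>
    hE1 (b j).2 e (Submodule.mem_span_singleton_self e)⟩

variable [DecidableEq ι]

theorem mulVec_injective_of_mem_evenGroup {T : Submodule K (ι → K)} {g : Matrix ι ι K}
    (hg : g ∈ evenGroup T) : Function.Injective (g *ᵥ ·) := by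
  intro x y h
  have := congrArg (gᵀ *ᵥ ·) h
  simpa [transpose_mul_of_mem_evenGroup hg] using this

theorem IsFrame.mulVec {m : ℕ} {e : ι → K} {f : Fin m → ι → K} (hf : IsFrame e f)
    {g : Matrix ι ι K} (hg : g ∈ evenGroup (Submodule.span K {e})) :
    IsFrame e fun j => g *ᵥ f j where
  linearIndependent := hf.linearIndependent.map' g.mulVecLin
    (LinearMap.ker_eq_bot.2 (mulVec_injective_of_mem_evenGroup hg))
  dotProduct_eq_zero j k := by
    rw [dotProduct_mulVec_of_mem_evenGroup hg, hf.dotProduct_eq_zero]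
  dotProduct_left j := by
    have h := dotProduct_mulVec_of_mem_evenGroup hg e (f j)
    rwa [mulVec_of_mem_evenGroup hg (Submodule.mem_span_singleton_self e),
      hf.dotProduct_left j] at h

/-- The even products of reflections act transitively on frames of small length. -/
theorem exists_evenGroup_frame (h2 : (2 : K) ≠ 0) {m : ℕ} (hm : 2 * (m + 1) ≤ Fintype.card ι)
    {e : ι → K} (he : e ⬝ᵥ e ≠ 0) {f x : Fin m → ι → K} (hf : IsFrame e f) (hx : IsFrame e x) :
    ∃ g ∈ evenGroup (Submodule.span K {e}), ∀ j, g *ᵥ f j = x j := by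
  suffices h : ∀ r ≤ m, ∃ g ∈ evenGroup (Submodule.span K {e}),
      ∀ j : Fin m, (j : ℕ) < r → g *ᵥ f j = x j by
    obtain ⟨g, hg, h⟩ := h m le_rfl
    exact ⟨g, hg, fun j => h j j.2⟩
  intro r
  induction r with
  | zero => exact fun _ => ⟨1, one_mem _, fun j hj => absurd hj (Nat.not_lt_zero _)⟩
  | succ r ih =>
    intro hr
    obtain ⟨g, hg, hgr⟩ := ih (by omega)
    let r' : Fin m := ⟨r, hr⟩
    have hgf := hf.mulVec hg
    have himg : (fun j => g *ᵥ f j) '' {j | j < r'} = x '' {j | j < r'} :=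
      Set.image_congr fun j hj => hgr j hj
    have hperp : ∀ z : Fin m → ι → K, IsFrame e z →
        z r' ∈ perp (Submodule.span K {e} ⊔ Submodule.span K (z '' {j | j < r'})) := by
      intro z hz
      rw [mem_perp_sup, mem_perp_span, mem_perp_span]
      refine ⟨?_, ?_⟩
      · rintro _ rfl
        exact hz.dotProduct_left _
      · rintro _ ⟨j, -, rfl⟩
        exact hz.dotProduct_eq_zero _ _
    have hfn := hgf.notMem_sup he r'
    have hfp := hperp _ hgf
    rw [himg] at hfn hfp
    obtain ⟨g', hg', h⟩ := exists_evenGroup_mulVec_eq h2 (hperp x hx) hfp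
      (hx.dotProduct_eq_zero _ _) (hgf.dotProduct_eq_zero _ _) (hx.notMem_sup he r') hfn (by
        -- The parity-correcting w is taken orthogonal to e and the whole frame. Their span has at
        -- most half the total dimension, and since it contains e the borderline case is allowed.
        obtain ⟨w, hw, hww⟩ := exists_mem_perp_not_isotropic_of_mem h2
          (Submodule.span K {e} ⊔ Submodule.span K (Set.range fun j => g *ᵥ f j)) (by
            have h1 := Submodule.finrank_add_le_finrank_add_finrank (Submodule.span K {e})
              (Submodule.span K (Set.range fun j => g *ᵥ f j))
            have h3 : finrank K (Submodule.span K {e}) ≤ 1 :=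
              (finrank_span_le_card {e}).trans (by simp)
            have h4 : finrank K (Submodule.span K (Set.range fun j => g *ᵥ f j)) ≤ m :=
              (finrank_range_le_card _).trans (by simp)
            omega) (Submodule.mem_sup_left (Submodule.mem_span_singleton_self e)) he
        refine ⟨w, perp_anti ?_ hw, hww⟩
        refine sup_le (sup_le le_sup_left ?_) ?_
        · rw [← himg]
          exact le_sup_of_le_right (Submodule.span_mono (Set.image_subset_range _ _))
        · rw [Submodule.span_singleton_le_iff_mem]
          exact Submodule.mem_sup_right (Submodule.subset_span ⟨r', rfl⟩))
    refine ⟨g' * g, mul_mem (evenGroup_anti le_sup_left hg') hg, fun j hj => ?_⟩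
    rw [← mulVec_mulVec]
    rcases Nat.lt_succ_iff_lt_or_eq.1 hj with h1 | h1
    · rw [hgr j h1]
      exact mulVec_of_mem_evenGroup hg'
        (Submodule.mem_sup_right (Submodule.subset_span ⟨j, h1, rfl⟩))
    · rw [show j = r' from Fin.ext h1]
      exact h

end Frames

theorem col_injective {K ι κ : Type*} {A B : Matrix ι κ K} (h : ∀ j, A.col j = B.col j) :
    A = B := by
  ext r j
  exact congrFun (h j) r

/-! ### Matrices factored through a frame and a last vector -/

section FrameMatrix

variable {K ι : Type*} [Field K] {m : ℕ}

/-- The matrix with columns `f` and a last column `l`. -/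
def frameMat (f : Fin m → ι → K) (l : ι → K) : Matrix ι (Fin (m + 1)) K :=
  (of (Fin.snoc (α := fun _ => ι → K) f l))ᵀ

/-- The matrices whose last row starts with `a` zeros. -/
def admissible (K : Type*) [Field K] (m a : ℕ) : Set (Matrix (Fin (m + 1)) (Fin (m + 1)) K) :=
  {M | ∀ j : Fin (m + 1), (j : ℕ) < a → M (Fin.last m) j = 0}

theorem frameMat_mul_col (f : Fin m → ι → K) (l : ι → K) (M : Matrix (Fin (m + 1)) (Fin (m + 1)) K)
    (j : Fin (m + 1)) :
    (frameMat f l * M).col j = ∑ k, M k.castSucc j • f k + M (Fin.last m) j • l := by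
  ext r
  simp [Matrix.mul_apply, Fin.sum_univ_castSucc, frameMat, mul_comm]

theorem mul_frameMat [Fintype ι] (g : Matrix ι ι K) (f : Fin m → ι → K) (l : ι → K) :
    g * frameMat f l = frameMat (fun j => g *ᵥ f j) (g *ᵥ l) := by
  ext r j
  induction j using Fin.lastCases with
  | last => simp [Matrix.mul_apply, frameMat, mulVec, dotProduct]
  | cast j => simp [Matrix.mul_apply, frameMat, mulVec, dotProduct]

theorem exists_frameMat_mul_eq {f : Fin m → ι → K} {l : ι → K} {a : ℕ}
    {Y : Matrix ι (Fin (m + 1)) K}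
    (hY : ∀ j, Y.col j ∈ Submodule.span K (Set.range f) ⊔ Submodule.span K {l})
    (hYa : ∀ j : Fin (m + 1), (j : ℕ) < a → Y.col j ∈ Submodule.span K (Set.range f)) :
    ∃ M ∈ admissible K m a, Y = frameMat f l * M := by
  have h : ∀ j, ∃ (b : Fin m → K) (c : K), Y.col j = ∑ k, b k • f k + c • l ∧
      ((j : ℕ) < a → c = 0) := by
    intro j
    by_cases hj : (j : ℕ) < a
    · obtain ⟨b, hb⟩ := (Submodule.mem_span_range_iff_exists_fun K).1 (hYa j hj)
      exact ⟨b, 0, by rw [hb, zero_smul, add_zero], fun _ => rfl⟩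
    · obtain ⟨y, hy, z, hz, hyz⟩ := Submodule.mem_sup.1 (hY j)
      obtain ⟨b, hb⟩ := (Submodule.mem_span_range_iff_exists_fun K).1 hy
      obtain ⟨c, rfl⟩ := Submodule.mem_span_singleton.1 hz
      exact ⟨b, c, by rw [hb, hyz], fun h => absurd h hj⟩
  choose b c h1 h3 using h
  refine ⟨of fun k j => Fin.snoc (α := fun _ => K) (b j) (c j) k, fun j hj => ?_, ?_⟩
  · simp [h3 j hj]
  · refine col_injective fun j => ?_
    rw [h1, frameMat_mul_col]
    simp

theorem frameMat_mul_col_mem (f : Fin m → ι → K) (l : ι → K)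
    (M : Matrix (Fin (m + 1)) (Fin (m + 1)) K) (j : Fin (m + 1)) :
    (frameMat f l * M).col j ∈ Submodule.span K (Set.range f) ⊔ Submodule.span K {l} := by
  rw [frameMat_mul_col]
  exact Submodule.add_mem_sup (Submodule.sum_mem _ fun k _ =>
    Submodule.smul_mem _ _ (Submodule.subset_span ⟨k, rfl⟩))
    (Submodule.smul_mem _ _ (Submodule.mem_span_singleton_self l))

theorem frameMat_mul_col_mem_of_lt (f : Fin m → ι → K) (l : ι → K) {a : ℕ}
    {M : Matrix (Fin (m + 1)) (Fin (m + 1)) K} (hM : M ∈ admissible K m a) {j : Fin (m + 1)}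
    (hj : (j : ℕ) < a) : (frameMat f l * M).col j ∈ Submodule.span K (Set.range f) := by
  rw [frameMat_mul_col, hM j hj, zero_smul, add_zero]
  exact Submodule.sum_mem _ fun k _ => Submodule.smul_mem _ _ (Submodule.subset_span ⟨k, rfl⟩)

/-- Replacing the last vector of a frame inside the span. -/
theorem exists_frameMat_mul_eq_of_mem {f : Fin m → ι → K} {l l' : ι → K} {a : ℕ}
    {M : Matrix (Fin (m + 1)) (Fin (m + 1)) K} (hM : M ∈ admissible K m a)
    (hl : l ∈ Submodule.span K (Set.range f) ⊔ Submodule.span K {l'}) :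
    ∃ M' ∈ admissible K m a, frameMat f l * M = frameMat f l' * M' := by
  refine exists_frameMat_mul_eq (fun j => ?_) fun j hj => frameMat_mul_col_mem_of_lt f l hM hj
  have h : Submodule.span K (Set.range f) ⊔ Submodule.span K {l} ≤
      Submodule.span K (Set.range f) ⊔ Submodule.span K {l'} :=
    sup_le le_sup_left (by rwa [Submodule.span_singleton_le_iff_mem])
  exact h (frameMat_mul_col_mem f l M j)

end FrameMatrix

/-! ### Normal form of isotropic matrices -/

section Decomposition

variable {K ι : Type*} [Field K] [Fintype ι] [DecidableEq ι] {m : ℕ}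

/-- A frame of F is moved to the fixed frame f, where span(first a columns) ⊆ F ⊆ E ∩ e^⊥ and E is
an isotropic space of dimension m + 1 containing all columns. Only l remains undetermined; the first
a columns need no l, hence the zeros in M. -/
theorem exists_decomposition [IsAlgClosed K] (h2 : (2 : K) ≠ 0)
    (hm : 2 * (m + 1) ≤ Fintype.card ι) {e : ι → K} (he : e ⬝ᵥ e ≠ 0) {f : Fin m → ι → K}
    (hf : IsFrame e f) {a : ℕ} (ha : a ≤ m) {Y : Matrix ι (Fin (m + 1)) K} (hY : Yᵀ * Y = 0)
    (hYa : ∀ j : Fin (m + 1), (j : ℕ) < a → e ⬝ᵥ Y.col j = 0) :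
    ∃ g ∈ evenGroup (Submodule.span K {e}), ∃ l ∈ perp (Submodule.span K (Set.range f)),
      l ⬝ᵥ l = 0 ∧ l ∉ Submodule.span K (Set.range f) ∧
        ∃ M ∈ admissible K m a, Y = g * frameMat f l * M := by
  have hdot : ∀ j k, Y.col j ⬝ᵥ Y.col k = 0 := fun j k => congrFun (congrFun hY j) k
  have hE0 : ∀ x ∈ Submodule.span K (Set.range Y.col), x ⬝ᵥ x = 0 := by
    have h1 : Submodule.span K (Set.range Y.col) ≤ perp (Submodule.span K (Set.range Y.col)) := by
      rw [Submodule.span_le]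
      rintro _ ⟨j, rfl⟩
      rw [SetLike.mem_coe, mem_perp_span]
      rintro _ ⟨k, rfl⟩
      exact hdot k j
    exact fun x hx => h1 hx x hx
  obtain ⟨E, hYE, -, hE, hEn⟩ := exists_isotropic_ge h2 ⊥ (m + 1) (by simpa using hm)
    (Submodule.span K (Set.range Y.col)) (by rw [perp_bot]; exact le_top) hE0
    ((finrank_range_le_card _).trans (by simp))
  have hA : Submodule.span K (Y.col '' {j | (j : ℕ) < a}) ≤ E ⊓ perp (Submodule.span K {e}) := by
    rw [Submodule.span_le]
    rintro _ ⟨j, hj, rfl⟩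
    refine ⟨hYE (Submodule.subset_span ⟨j, rfl⟩), ?_⟩
    rw [SetLike.mem_coe, mem_perp_span]
    rintro _ rfl
    exact hYa j hj
  have hAa : finrank K (Submodule.span K (Y.col '' {j | (j : ℕ) < a})) ≤ m := by
    have : Y.col '' {j | (j : ℕ) < a} ⊆ Set.range fun j : Fin m => Y.col j.castSucc := by
      rintro _ ⟨j, hj, rfl⟩
      have hj' : (j : ℕ) < a := hj
      exact ⟨⟨j, by omega⟩, rfl⟩
    refine (Submodule.finrank_mono (Submodule.span_mono this)).trans ?_
    exact (finrank_range_le_card _).trans (by simp)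
  -- Orthogonality to e costs at most one of the m + 1 dimensions of E. With a ≤ m this leaves room
  -- for F.
  have hB : m ≤ finrank K (E ⊓ perp (Submodule.span K {e}) : Submodule K (ι → K)) := by
    have h1 := Submodule.finrank_sup_add_finrank_inf_eq E (perp (Submodule.span K {e}))
    have h3 : finrank K (Submodule.span K {e}) ≤ 1 := (finrank_span_le_card {e}).trans (by simp)
    have h4 := Submodule.finrank_le (E ⊔ perp (Submodule.span K {e}))
    rw [finrank_perp, hEn] at h1
    rw [finrank_fintype_fun_eq_card] at h4
    omega
  obtain ⟨F, hAF, hFB, hFm⟩ := exists_between_finrank hA hAa hB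
  let b := finBasisOfFinrankEq K F hFm
  have hbspan : Submodule.span K (Set.range fun j => (b j : ι → K)) = F := by
    have h1 := congrArg (Submodule.map F.subtype) b.span_eq
    rw [Submodule.map_span, ← Set.range_comp, Submodule.map_subtype_top] at h1
    exact h1
  have hx : IsFrame e fun j => (b j : ι → K) :=
    ⟨b.linearIndependent.map' F.subtype F.ker_subtype, fun j k =>
      dotProduct_eq_zero_of_isotropic h2 hE (hFB (b j).2).1 (hFB (b k).2).1, fun j =>
      (hFB (b j).2).2 e (Submodule.mem_span_singleton_self e)⟩
  obtain ⟨g, hg, hgf⟩ := exists_evenGroup_frame h2 hm he hf hx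
  have hFE : F ≤ E := hFB.trans inf_le_left
  obtain ⟨z, hzE, hzF⟩ : ∃ z ∈ E, z ∉ F := by
    by_contra! hcon
    exact absurd (Submodule.finrank_mono (show E ≤ F from hcon)) (by omega)
  have hE' : F ⊔ Submodule.span K {z} = E := by
    apply Submodule.eq_of_le_of_finrank_le
    · exact sup_le hFE (by rwa [Submodule.span_singleton_le_iff_mem])
    · have h4 : F < F ⊔ Submodule.span K {z} := by
        refine lt_of_le_of_ne le_sup_left fun h => hzF ?_
        rw [h]
        exact Submodule.mem_sup_right (Submodule.mem_span_singleton_self z)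
      have := Submodule.finrank_lt_finrank_of_lt h4
      omega
  obtain ⟨M, hM, hYM⟩ := exists_frameMat_mul_eq (f := fun j => (b j : ι → K)) (l := z) (a := a)
    (Y := Y) (fun j => by
      rw [hbspan, hE']
      exact hYE (Submodule.subset_span ⟨j, rfl⟩)) (fun j hj => by
      rw [hbspan]
      exact hAF (Submodule.subset_span ⟨j, hj, rfl⟩))
  have hgg : g * gᵀ = 1 := mul_eq_one_comm.1 (transpose_mul_of_mem_evenGroup hg)
  have hgz : g *ᵥ (gᵀ *ᵥ z) = z := by rw [mulVec_mulVec, hgg, one_mulVec]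
  refine ⟨g, hg, gᵀ *ᵥ z, ?_, ?_, ?_, M, hM, ?_⟩
  · rw [mem_perp_span]
    rintro _ ⟨j, rfl⟩
    rw [← dotProduct_mulVec_of_mem_evenGroup hg, hgz, hgf]
    exact dotProduct_eq_zero_of_isotropic h2 hE (hFE (b j).2) hzE
  · rw [← dotProduct_mulVec_of_mem_evenGroup hg, hgz]
    exact hE z hzE
  · intro h
    apply hzF
    have h1 := Submodule.mem_map_of_mem (f := g.mulVecLin) h
    rw [Submodule.map_span, ← Set.range_comp, mulVecLin_apply, hgz] at h1
    have h3 : g.mulVecLin ∘ f = fun j => (b j : ι → K) := funext hgf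
    rwa [h3, hbspan] at h1
  · rw [mul_frameMat, hgz, hYM]
    simp only [hgf]

end Decomposition

end SymmetricNullcone

namespace SymmetricNullcone

open Matrix Module

/-! ### Irreducibility through curves, and components of a union -/

section Zariski

variable {K σ : Type*} [Field K]

theorem isClosed_zariski_iff {Z : Set (σ → K)} :
    @IsClosed _ (zariskiTopology K σ) Z ↔
      ∃ I : Ideal (MvPolynomial σ K), Z = MvPolynomial.zeroLocus K I := by
  rw [← @isOpen_compl_iff _ _ (zariskiTopology K σ)]
  change Zᶜᶜ ∈ _ ↔ _
  rw [compl_compl]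
  rfl

theorem isZariskiIrreducible_iff {Z : Set (σ → K)} :
    IsZariskiIrreducible Z ↔ Z.Nonempty ∧ ∀ I J : Ideal (MvPolynomial σ K),
      Z ⊆ MvPolynomial.zeroLocus K I ∪ MvPolynomial.zeroLocus K J →
        Z ⊆ MvPolynomial.zeroLocus K I ∨ Z ⊆ MvPolynomial.zeroLocus K J := by
  refine and_congr Iff.rfl
    ((@isPreirreducible_iff_isClosed_union_isClosed _ (zariskiTopology K σ) Z).trans ?_)
  constructor
  · exact fun h I J => h _ _ (isClosed_zariski_iff.2 ⟨I, rfl⟩) (isClosed_zariski_iff.2 ⟨J, rfl⟩)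
  · intro h z₁ z₂ h₁ h₂
    obtain ⟨I, rfl⟩ := isClosed_zariski_iff.1 h₁
    obtain ⟨J, rfl⟩ := isClosed_zariski_iff.1 h₂
    exact h I J

/-- A set in which any two points lie on a rational curve is irreducible. -/
theorem isZariskiIrreducible_of_curves [Infinite K] {Z : Set (σ → K)} (hZ : Z.Nonempty)
    (h : ∀ y₀ ∈ Z, ∀ y₁ ∈ Z, ∃ (F : σ → Polynomial K) (q : Polynomial K), q ≠ 0 ∧
      (∀ t, q.eval t ≠ 0 → (fun s => (F s).eval t) ∈ Z) ∧
      (fun s => (F s).eval 0) = y₀ ∧ (fun s => (F s).eval 1) = y₁) : IsZariskiIrreducible Z := by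
  rw [isZariskiIrreducible_iff]
  refine ⟨hZ, fun I J hIJ => ?_⟩
  by_contra! hcon
  obtain ⟨⟨y₀, hy₀, hI⟩, ⟨y₁, hy₁, hJ⟩⟩ :=
    And.intro (Set.not_subset.1 hcon.1) (Set.not_subset.1 hcon.2)
  obtain ⟨F, q, hq, hFZ, rfl, rfl⟩ := h y₀ hy₀ y₁ hy₁
  simp only [MvPolynomial.mem_zeroLocus_iff, not_forall] at hI hJ
  obtain ⟨a, ha, ha0⟩ := hI
  obtain ⟨b, hb, hb1⟩ := hJ
  have hcomp : ∀ (p : MvPolynomial σ K) (t : K),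
      (MvPolynomial.aeval F p).eval t = MvPolynomial.aeval (fun s => (F s).eval t) p := by
    intro p t
    induction p using MvPolynomial.induction_on with
    | C c => simp
    | add p q hp hq => simp [hp, hq]
    | mul_X p s hp => simp [hp]
  rw [← hcomp] at ha0 hb1
  have ha' : MvPolynomial.aeval F a ≠ 0 := fun h => ha0 (by rw [h, Polynomial.eval_zero])
  have hb' : MvPolynomial.aeval F b ≠ 0 := fun h => hb1 (by rw [h, Polynomial.eval_zero])
  -- Pulled back to the curve, a and b are nonzero polynomials in t, witnessed at 0 and 1. Yet a b q
  -- vanishes at every t, impossible over an infinite field.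
  apply mul_ne_zero (mul_ne_zero ha' hb') hq
  apply Polynomial.zero_of_eval_zero
  intro t
  rw [Polynomial.eval_mul, Polynomial.eval_mul]
  by_cases ht : q.eval t = 0
  · rw [ht, mul_zero]
  · rcases hIJ (hFZ t ht) with h1 | h1
    · rw [hcomp a, MvPolynomial.mem_zeroLocus_iff.1 h1 a ha, zero_mul, zero_mul]
    · rw [hcomp b, MvPolynomial.mem_zeroLocus_iff.1 h1 b hb, mul_zero, zero_mul]

theorem zariskiComponents_eq_pair {V : Set (σ → K)} {I J : Ideal (MvPolynomial σ K)}
    (hV : V = MvPolynomial.zeroLocus K I ∪ MvPolynomial.zeroLocus K J)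
    (hI : IsZariskiIrreducible (MvPolynomial.zeroLocus K I))
    (hJ : IsZariskiIrreducible (MvPolynomial.zeroLocus K J))
    (hIJ : ¬ MvPolynomial.zeroLocus K I ⊆ MvPolynomial.zeroLocus K J)
    (hJI : ¬ MvPolynomial.zeroLocus K J ⊆ MvPolynomial.zeroLocus K I) :
    zariskiComponents V = {MvPolynomial.zeroLocus K I, MvPolynomial.zeroLocus K J} := by
  subst hV
  have key : ∀ W : Set (σ → K), W ⊆ MvPolynomial.zeroLocus K I ∪ MvPolynomial.zeroLocus K J →
      IsZariskiIrreducible W →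
        W ⊆ MvPolynomial.zeroLocus K I ∨ W ⊆ MvPolynomial.zeroLocus K J :=
    fun W hW hWi => (isZariskiIrreducible_iff.1 hWi).2 I J hW
  ext Z
  simp only [Set.mem_insert_iff, Set.mem_singleton_iff]
  constructor
  · rintro ⟨⟨hZV, hZ⟩, hmax⟩
    rcases key Z hZV hZ with h | h
    · exact Or.inl (h.antisymm (hmax ⟨Set.subset_union_left, hI⟩ h))
    · exact Or.inr (h.antisymm (hmax ⟨Set.subset_union_right, hJ⟩ h))
  · rintro (rfl | rfl)
    · refine ⟨⟨Set.subset_union_left, hI⟩, fun W hW hZW => ?_⟩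
      rcases key W hW.1 hW.2 with h | h
      · exact h
      · exact absurd (hZW.trans h) hIJ
    · refine ⟨⟨Set.subset_union_right, hJ⟩, fun W hW hZW => ?_⟩
      rcases key W hW.1 hW.2 with h | h
      · exact absurd (hZW.trans h) hJI
      · exact h

end Zariski

/-! ### Rational curves through even products of reflections -/

section Curves

variable {K ι : Type*} [Field K]

/-- Evaluation of a matrix of polynomials at a point. -/
def evalMat {ι κ : Type*} (t : K) (A : Matrix ι κ (Polynomial K)) : Matrix ι κ K :=
  A.map (Polynomial.evalRingHom t)

/-- Up to scalars, any two elements of `S` lie on a rational curve inside `S`. -/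
def JoinedIn (S : Set (Matrix ι ι K)) (g₀ g₁ : Matrix ι ι K) : Prop :=
  ∃ (A : Matrix ι ι (Polynomial K)) (q : Polynomial K), q ≠ 0 ∧
    (∀ t, q.eval t ≠ 0 → ∃ g ∈ S, ∃ c : K, evalMat t A = c • g) ∧
    (∃ c : K, c ≠ 0 ∧ evalMat 0 A = c • g₀) ∧ ∃ c : K, c ≠ 0 ∧ evalMat 1 A = c • g₁

theorem evalMat_zero_lineMap {κ : Type*} (A B : Matrix ι κ K) :
    evalMat 0 (A.map Polynomial.C + (Polynomial.X : Polynomial K) • (B - A).map Polynomial.C) =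
      A := by
  ext r j
  simp [evalMat]

theorem evalMat_one_lineMap {κ : Type*} (A B : Matrix ι κ K) :
    evalMat 1 (A.map Polynomial.C + (Polynomial.X : Polynomial K) • (B - A).map Polynomial.C) =
      B := by
  ext r j
  simp [evalMat]

theorem joinedIn_self {S : Set (Matrix ι ι K)} {g : Matrix ι ι K} (hg : g ∈ S) :
    JoinedIn S g g := by
  have h : ∀ t, evalMat t (g.map Polynomial.C) = (1 : K) • g := by
    intro t
    ext r j
    simp [evalMat]
  exact ⟨g.map Polynomial.C, 1, one_ne_zero, fun t _ => ⟨g, hg, 1, h t⟩, ⟨1, one_ne_zero, h 0⟩,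
    1, one_ne_zero, h 1⟩

variable [Fintype ι]

theorem evalMat_mul (t : K) (A B : Matrix ι ι (Polynomial K)) :
    evalMat t (A * B) = evalMat t A * evalMat t B := Matrix.map_mul

theorem JoinedIn.mul {S S' P : Set (Matrix ι ι K)} {g₀ g₁ g₀' g₁' : Matrix ι ι K}
    (h : JoinedIn S g₀ g₁) (h' : JoinedIn S' g₀' g₁') (hP : ∀ g ∈ S, ∀ g' ∈ S', g * g' ∈ P) :
    JoinedIn P (g₀ * g₀') (g₁ * g₁') := by
  obtain ⟨A, q, hq, h1, ⟨c, hc, h2⟩, d, hd, h3⟩ := h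
  obtain ⟨A', q', hq', h1', ⟨c', hc', h2'⟩, d', hd', h3'⟩ := h'
  refine ⟨A * A', q * q', mul_ne_zero hq hq', fun t ht => ?_, ⟨c * c', mul_ne_zero hc hc', ?_⟩,
    d * d', mul_ne_zero hd hd', ?_⟩
  · rw [Polynomial.eval_mul] at ht
    obtain ⟨g, hg, b, hb⟩ := h1 t (left_ne_zero_of_mul ht)
    obtain ⟨g', hg', b', hb'⟩ := h1' t (right_ne_zero_of_mul ht)
    refine ⟨_, hP g hg g' hg', b * b', ?_⟩
    rw [evalMat_mul, hb, hb', Matrix.smul_mul, Matrix.mul_smul, smul_smul]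
  · rw [evalMat_mul, h2, h2', Matrix.smul_mul, Matrix.mul_smul, smul_smul]
  · rw [evalMat_mul, h3, h3', Matrix.smul_mul, Matrix.mul_smul, smul_smul]

/-- A matrix as a point of affine space. -/
def toPoint {ι κ : Type*} (Y : Matrix ι κ K) : ι × κ → K := fun v => Y v.1 v.2

/-- Curves in S known only up to scalars suffice, because the admissible M form a linear space that
absorbs the scalars. -/
theorem isZariskiIrreducible_orbit [Infinite K] {m a : ℕ} {S : Set (Matrix ι ι K)}
    (hS : S.Nonempty) (hJ : ∀ g₀ ∈ S, ∀ g₁ ∈ S, JoinedIn S g₀ g₁)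
    (X : Matrix ι (Fin (m + 1)) K) :
    IsZariskiIrreducible {y | ∃ g ∈ S, ∃ M ∈ admissible K m a, y = toPoint (g * X * M)} := by
  apply isZariskiIrreducible_of_curves
  · obtain ⟨g, hg⟩ := hS
    exact ⟨_, g, hg, 0, fun _ _ => rfl, rfl⟩
  rintro _ ⟨g₀, hg₀, M₀, hM₀, rfl⟩ _ ⟨g₁, hg₁, M₁, hM₁, rfl⟩
  obtain ⟨A, q, hq, h1, ⟨c₀, hc₀, h2⟩, c₁, hc₁, h3⟩ := hJ g₀ hg₀ g₁ hg₁
  -- The inverse scalars at the endpoints cancel those carried by the curve A.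
  let B : Matrix (Fin (m + 1)) (Fin (m + 1)) (Polynomial K) := (c₀⁻¹ • M₀).map Polynomial.C +
    (Polynomial.X : Polynomial K) • (c₁⁻¹ • M₁ - c₀⁻¹ • M₀).map Polynomial.C
  let F : Matrix ι (Fin (m + 1)) (Polynomial K) := A * X.map Polynomial.C * B
  have hF : ∀ t, evalMat t F = evalMat t A * X * evalMat t B := by
    intro t
    have : evalMat t (X.map Polynomial.C) = X := by
      ext r j
      simp [evalMat]
    simp only [F, evalMat, Matrix.map_mul] at this ⊢
    rw [this]
  have hpt : ∀ t, (fun s : ι × Fin (m + 1) => (F s.1 s.2).eval t) = toPoint (evalMat t F) :=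
    fun t => rfl
  refine ⟨fun s => F s.1 s.2, q, hq, fun t ht => ?_, ?_, ?_⟩
  · obtain ⟨g, hg, c, hc⟩ := h1 t ht
    refine ⟨g, hg, c • evalMat t B, fun j hj => ?_, ?_⟩
    · simp [evalMat, B, hM₀ j hj, hM₁ j hj]
    · rw [hpt, hF, hc, Matrix.smul_mul, Matrix.smul_mul, Matrix.mul_smul]
  · rw [hpt, hF, h2, evalMat_zero_lineMap, Matrix.smul_mul, Matrix.smul_mul, Matrix.mul_smul,
      smul_smul, mul_inv_cancel₀ hc₀, one_smul]
  · rw [hpt, hF, h3, evalMat_one_lineMap, Matrix.smul_mul, Matrix.smul_mul, Matrix.mul_smul,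
      smul_smul, mul_inv_cancel₀ hc₁, one_smul]

variable [DecidableEq ι]

/-- Along the line y from v to w, the denominator-free matrix (y·y)1 - 2yyᵀ is polynomial and is a
multiple of the reflection in y whenever y·y ≠ 0, so q = y·y. -/
theorem joinedIn_reflection {T : Submodule K (ι → K)} {u v w : ι → K} (hu : u ∈ perp T)
    (hv : v ∈ perp T) (hw : w ∈ perp T) (huu : u ⬝ᵥ u ≠ 0) (hvv : v ⬝ᵥ v ≠ 0) (hww : w ⬝ᵥ w ≠ 0) :
    JoinedIn (evenGroup T : Set (Matrix ι ι K)) (reflection u * reflection v)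
      (reflection u * reflection w) := by
  let y : ι → Polynomial K := fun r => Polynomial.C (v r) + Polynomial.X * Polynomial.C (w r - v r)
  let A : Matrix ι ι (Polynomial K) := (reflection u).map Polynomial.C *
    ((y ⬝ᵥ y) • (1 : Matrix ι ι (Polynomial K)) - (2 : Polynomial K) • vecMulVec y y)
  have hy : ∀ t, (y ⬝ᵥ y).eval t = (v + t • (w - v)) ⬝ᵥ (v + t • (w - v)) := by
    intro t
    simp [y, dotProduct, Polynomial.eval_finsetSum]
  have hA : ∀ t, (v + t • (w - v)) ⬝ᵥ (v + t • (w - v)) ≠ 0 → evalMat t A =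
      ((v + t • (w - v)) ⬝ᵥ (v + t • (w - v))) • (reflection u * reflection (v + t • (w - v))) := by
    intro t ht
    rw [evalMat_mul, ← Matrix.mul_smul]
    congr 1
    · ext r j
      simp [evalMat]
    · ext r j
      have h1 : evalMat t ((y ⬝ᵥ y) • (1 : Matrix ι ι (Polynomial K)) -
          (2 : Polynomial K) • vecMulVec y y) r j = (y ⬝ᵥ y).eval t * (1 : Matrix ι ι K) r j -
          2 * ((v + t • (w - v)) r * (v + t • (w - v)) j) := by
        have hyr : ∀ r, (y r).eval t = (v + t • (w - v)) r := by
          intro r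
          simp [y]
        by_cases hrj : r = j
        · subst hrj
          simp only [evalMat, Matrix.map_apply, Matrix.sub_apply, Matrix.smul_apply, one_apply_eq,
            vecMulVec_apply, Polynomial.coe_evalRingHom, smul_eq_mul, Polynomial.eval_sub,
            Polynomial.eval_mul, hyr, Polynomial.eval_one, Polynomial.eval_ofNat]
        · simp only [evalMat, Matrix.map_apply, Matrix.sub_apply, Matrix.smul_apply,
            one_apply_ne hrj, vecMulVec_apply, Polynomial.coe_evalRingHom, smul_eq_mul,
            Polynomial.eval_sub, Polynomial.eval_mul, hyr, Polynomial.eval_zero,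
            Polynomial.eval_ofNat]
      rw [h1, hy]
      simp only [reflection, Matrix.smul_apply, Matrix.sub_apply, smul_eq_mul, vecMulVec_apply]
      field_simp
  have h0 : v + (0 : K) • (w - v) = v := by rw [zero_smul, add_zero]
  have h1 : v + (1 : K) • (w - v) = w := by rw [one_smul, add_sub_cancel]
  refine ⟨A, y ⬝ᵥ y, fun h => ?_, fun t ht => ?_, ⟨v ⬝ᵥ v, hvv, ?_⟩, w ⬝ᵥ w, hww, ?_⟩
  · have := hy 0
    rw [h, h0, Polynomial.eval_zero] at this
    exact hvv this.symm
  · rw [hy] at ht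
    exact ⟨_, mul_reflection_mem hu (Submodule.add_mem _ hv (Submodule.smul_mem _ _
      (Submodule.sub_mem _ hw hv))) huu ht, _, hA t ht⟩
  · have := hA 0
    rw [h0] at this
    exact this hvv
  · have := hA 1
    rw [h1] at this
    exact this hww

/-- Since ρ_u ρ_u = 1, each generator is joined to 1. Multiplying a curve from g₀ to 1 by a curve
from 1 to g₁ avoids any concatenation of curves. -/
theorem joinedIn_evenGroup {T : Submodule K (ι → K)} {g₀ g₁ : Matrix ι ι K}
    (h₀ : g₀ ∈ evenGroup T) (h₁ : g₁ ∈ evenGroup T) :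
    JoinedIn (evenGroup T : Set (Matrix ι ι K)) g₀ g₁ := by
  have key : ∀ g ∈ evenGroup T, JoinedIn (evenGroup T : Set (Matrix ι ι K)) 1 g ∧
      JoinedIn (evenGroup T : Set (Matrix ι ι K)) g 1 := by
    intro g hg
    induction hg using Submonoid.closure_induction with
    | mem g hg =>
      obtain ⟨u, hu, v, hv, huu, hvv, rfl⟩ := hg
      rw [← reflection_mul_self u]
      exact ⟨joinedIn_reflection hu hu hv huu huu hvv, joinedIn_reflection hu hv hu huu hvv huu⟩
    | one => exact ⟨joinedIn_self (one_mem _), joinedIn_self (one_mem _)⟩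
    | mul a b _ _ ha hb =>
      have h1 := ha.1.mul hb.1 (P := (evenGroup T : Set (Matrix ι ι K)))
        fun g hg g' hg' => mul_mem hg hg'
      have h2 := ha.2.mul hb.2 (P := (evenGroup T : Set (Matrix ι ι K)))
        fun g hg g' hg' => mul_mem hg hg'
      rw [Matrix.mul_one] at h1 h2
      exact ⟨h1, h2⟩
  have := (key g₀ h₀).2.mul (key g₁ h₁).1 (P := (evenGroup T : Set (Matrix ι ι K)))
    fun g hg g' hg' => mul_mem hg hg'
  rwa [Matrix.mul_one, Matrix.one_mul] at this

end Curves

end SymmetricNullcone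

namespace SymmetricNullcone

open Matrix Module

/-! ### Self-duality and relations between complementary minors -/

section Plucker

variable {K : Type*} [Field K] {d n : ℕ}

/-- The determinant of the square matrix with column blocks `X` and `Y`. -/
def glueDet (h : d = n + n) (X Y : Matrix (Fin d) (Fin n) K) : K :=
  ((fromCols X Y).submatrix id (rowEquiv h)).det

/-- The self-duality relation `det (Xᵗ Y) = δ det [X | Y]`, for all `X`. -/
def SelfDual (h : d = n + n) (δ : K) (Y : Matrix (Fin d) (Fin n) K) : Prop :=
  ∀ X : Matrix (Fin d) (Fin n) K, (Xᵀ * Y).det = δ * glueDet h X Y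

theorem glueDet_mul_left (h : d = n + n) (g : Matrix (Fin d) (Fin d) K)
    (X Y : Matrix (Fin d) (Fin n) K) : glueDet h (g * X) (g * Y) = g.det * glueDet h X Y := by
  rw [glueDet, ← mul_fromCols, glueDet, ← det_mul]
  rfl

theorem glueDet_mul_right (h : d = n + n) (X Y : Matrix (Fin d) (Fin n) K)
    (M : Matrix (Fin n) (Fin n) K) : glueDet h X (Y * M) = glueDet h X Y * M.det := by
  let B : Matrix (Fin n ⊕ Fin n) (Fin n ⊕ Fin n) K := fromBlocks 1 0 0 M
  have h1 : fromCols X (Y * M) = fromCols X Y * B := by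
    rw [fromCols_mul_fromBlocks]
    simp
  have h2 : M.det = (B.submatrix (rowEquiv h) (rowEquiv h)).det := by
    rw [det_submatrix_equiv_self, det_fromBlocks_zero₂₁, det_one, one_mul]
  rw [glueDet, h1, glueDet, h2, ← det_mul, submatrix_mul_equiv]

theorem SelfDual.mul_right {h : d = n + n} {δ : K} {Y : Matrix (Fin d) (Fin n) K}
    (hY : SelfDual h δ Y) (M : Matrix (Fin n) (Fin n) K) : SelfDual h δ (Y * M) := by
  intro X
  rw [← Matrix.mul_assoc, det_mul, hY X, glueDet_mul_right, mul_assoc]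

/-- The factor det g = ±1 is what separates the two families: even products keep δ, and a single
reflection negates it. -/
theorem SelfDual.mul_left {h : d = n + n} {δ : K} {Y : Matrix (Fin d) (Fin n) K}
    (hY : SelfDual h δ Y) {g : Matrix (Fin d) (Fin d) K} (hg : gᵀ * g = 1) :
    SelfDual h (δ * g.det) (g * Y) := by
  intro X
  have hg' : g * gᵀ = 1 := mul_eq_one_comm.1 hg
  have h1 := hY (gᵀ * X)
  rw [transpose_mul, transpose_transpose, Matrix.mul_assoc] at h1
  rw [h1]
  have h2 := glueDet_mul_left h g (gᵀ * X) Y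
  rw [← Matrix.mul_assoc, hg', Matrix.one_mul] at h2
  rw [h2]
  have h3 : g.det * g.det = 1 := by
    have := congrArg det hg
    rwa [det_mul, det_transpose, det_one] at this
  linear_combination -δ * glueDet h (gᵀ * X) Y * h3

/-- The product [Z | Y]ᵀ[X | Y] has blocks ZᵀX, 1, YᵀX, 0. For X = Z it yields det[Z | Y]² = (-1)ⁿ,
which fixes the duality constant up to sign. -/
theorem glueDet_mul_glueDet (h : d = n + n) {Z Y : Matrix (Fin d) (Fin n) K} (hZ : Zᵀ * Y = 1)
    (hY : Yᵀ * Y = 0) (X : Matrix (Fin d) (Fin n) K) :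
    glueDet h Z Y * glueDet h X Y = (-1) ^ n * (Xᵀ * Y).det := by
  have h1 : ((fromCols Z Y).submatrix id (rowEquiv h))ᵀ * (fromCols X Y).submatrix id (rowEquiv h) =
      (fromBlocks (Zᵀ * X) 1 (Yᵀ * X) 0).submatrix (rowEquiv h) (rowEquiv h) := by
    rw [← hZ, ← hY, ← fromRows_mul_fromCols, ← transpose_fromCols, transpose_submatrix]
    rfl
  -- A unimodular column operation replaces the upper left block by 1, so the Schur complement
  -- formula applies.
  have h2 : fromBlocks (Zᵀ * X) 1 (Yᵀ * X) 0 * fromBlocks 1 0 (1 - Zᵀ * X) 1 =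
      fromBlocks 1 1 (Yᵀ * X) (0 : Matrix (Fin n) (Fin n) K) := by
    rw [fromBlocks_multiply]
    simp
  have h3 := congrArg det h2
  rw [det_mul, det_fromBlocks_zero₁₂, det_one, mul_one, mul_one, det_fromBlocks_one₁₁,
    Matrix.mul_one, zero_sub, det_neg, Fintype.card_fin] at h3
  rw [glueDet, glueDet, ← det_transpose, ← det_mul, h1, det_submatrix_equiv_self, h3,
    ← det_transpose (Xᵀ * Y), transpose_mul, transpose_transpose]

/-- An isotropic matrix of full rank is self-dual up to sign. -/
theorem exists_selfDual (h : d = n + n) {i : K} (hi : i ^ 2 = -1) {Z Y : Matrix (Fin d) (Fin n) K}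
    (hZ : Zᵀ * Y = 1) (hY : Yᵀ * Y = 0) : SelfDual h (i ^ n) Y ∨ SelfDual h (-i ^ n) Y := by
  have h1 := glueDet_mul_glueDet h hZ hY
  have h2 := h1 Z
  rw [hZ, det_one, mul_one, ← hi, ← pow_mul, mul_comm 2 n, pow_mul] at h2
  have h4 : ((-1 : K) ^ n) * (-1) ^ n = 1 := by rw [← mul_pow]; simp
  have h5 : i ^ n * i ^ n = (-1) ^ n := by rw [← mul_pow, ← sq, hi]
  have h6 : ∀ X : Matrix (Fin d) (Fin n) K,
      (Xᵀ * Y).det = (-1) ^ n * glueDet h Z Y * glueDet h X Y := by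
    intro X
    linear_combination -(-1) ^ n * h1 X - (Xᵀ * Y).det * h4
  have h7 : (-1) ^ n * glueDet h Z Y = i ^ n ∨ (-1) ^ n * glueDet h Z Y = -i ^ n := by
    apply sq_eq_sq_iff_eq_or_eq_neg.1
    linear_combination (-1) ^ n * (-1) ^ n * h2 + (i ^ n) ^ 2 * h4
  rcases h7 with h7 | h7
  · exact Or.inl fun X => by rw [h6, h7]
  · exact Or.inr fun X => by rw [h6, h7]

/-- The relations between the maximal minors of `Y` on complementary sets of rows. -/
def MinorRel (δ : K) (Y : Matrix (Fin d) (Fin n) K) : Prop :=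
  ∀ (α : Finset (Fin d)) (hα : α.card = n) (hαc : αᶜ.card = n),
    (Y.submatrix (α.orderEmbOfFin hα) id).det =
      δ * ((sgn α : ℤ) : K) * (Y.submatrix (αᶜ.orderEmbOfFin hαc) id).det

theorem sgn_eq {p q : ℕ} (α : Finset (Fin d)) (hp : α.card = p) (hq : αᶜ.card = q)
    (h : d = p + q) : sgn α = Equiv.Perm.sign ((finCongr h).trans
      (finSumFinEquiv.symm.trans (finSumEquivOfFinset hp hq))) := by
  subst hp hq
  rfl

/-- Take for X the coordinate columns indexed by α. Listing the rows as (α, αᶜ) makes [X | Y] block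
triangular, at the cost of `sgn α`. -/
theorem SelfDual.minorRel {h : d = n + n} {δ : K} {Y : Matrix (Fin d) (Fin n) K}
    (hY : SelfDual h δ Y) : MinorRel δ Y := by
  intro α hα hαc
  let X : Matrix (Fin d) (Fin n) K := (1 : Matrix (Fin d) (Fin d) K).submatrix id
    (α.orderEmbOfFin hα)
  let κ := finSumEquivOfFinset hα hαc
  have h1 : Xᵀ * Y = Y.submatrix (α.orderEmbOfFin hα) id := by
    ext r j
    simp [X, Matrix.mul_apply, one_apply]
  have h2 : (fromCols X Y).submatrix κ id =
      fromBlocks 1 (Y.submatrix (α.orderEmbOfFin hα) id) 0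
        (Y.submatrix (αᶜ.orderEmbOfFin hαc) id) := by
    ext r j
    rcases r with r | r <;> rcases j with j | j
    · simp [κ, X, one_apply]
    · simp [κ]
    · have h3 : αᶜ.orderEmbOfFin hαc r ≠ α.orderEmbOfFin hα j := by
        intro h3
        have h4 := Finset.orderEmbOfFin_mem αᶜ hαc r
        rw [h3, Finset.mem_compl] at h4
        exact h4 (Finset.orderEmbOfFin_mem α hα j)
      simp [κ, X, one_apply, h3]
    · simp [κ]
  have h3 := congrArg det h2
  rw [det_fromBlocks_zero₂₁, det_one, one_mul] at h3
  have h4 : ((fromCols X Y).submatrix κ id).det = ((sgn α : ℤ) : K) * glueDet h X Y := by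
    rw [sgn_eq α hα hαc h, glueDet, ← det_permute, ← det_submatrix_equiv_self (rowEquiv h)]
    rfl
  rw [← h1, hY X, ← h3, h4]
  have h5 : ((sgn α : ℤ) : K) * ((sgn α : ℤ) : K) = 1 := by
    rw [← Int.cast_mul, ← Units.val_mul, Int.units_mul_self, Units.val_one, Int.cast_one]
  linear_combination -δ * glueDet h X Y * h5

theorem exists_minor_ne_zero {L : Matrix (Fin n) (Fin d) K} {Y : Matrix (Fin d) (Fin n) K}
    (hL : L * Y = 1) : ∃ (α : Finset (Fin d)) (hα : α.card = n),
      (Y.submatrix (α.orderEmbOfFin hα) id).det ≠ 0 := by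
  have hspan : Submodule.span K (Set.range Y.row) = ⊤ := by
    rw [← range_vecMulLinear, LinearMap.range_eq_top]
    exact vecMul_surjective_iff_exists_left_inverse.2 ⟨L, hL⟩
  obtain ⟨κ, b, hb, hbs, hbl⟩ := exists_linearIndependent' K Y.row
  rw [hspan] at hbs
  have : Fintype κ := Fintype.ofInjective b hb
  have hcard : Fintype.card κ = n := by
    rw [← finrank_eq_card_basis (Basis.mk hbl hbs.ge), finrank_fintype_fun_eq_card,
      Fintype.card_fin]
  have hα : (Finset.univ.image b).card = n := by
    rw [Finset.card_image_of_injective _ hb, Finset.card_univ, hcard]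
  refine ⟨Finset.univ.image b, hα, ?_⟩
  have h1 : ∀ k, ∃ c, b c = (Finset.univ.image b).orderEmbOfFin hα k := by
    intro k
    obtain ⟨c, -, hc⟩ := Finset.mem_image.1 (Finset.orderEmbOfFin_mem (Finset.univ.image b) hα k)
    exact ⟨c, hc⟩
  choose c hc using h1
  have hcinj : Function.Injective c := by
    intro k k' hk
    apply ((Finset.univ.image b).orderEmbOfFin hα).injective
    rw [← hc, ← hc, hk]
  have h2 : LinearIndependent K (Y.submatrix ((Finset.univ.image b).orderEmbOfFin hα) id).row := by
    have h3 := hbl.comp c hcinj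
    have h4 : (Y.row ∘ b) ∘ c =
        (Y.submatrix ((Finset.univ.image b).orderEmbOfFin hα) id).row := by
      funext k
      ext j
      simp [hc]
    rwa [h4] at h3
  rw [linearIndependent_rows_iff_isUnit, isUnit_iff_isUnit_det] at h2
  exact h2.ne_zero

theorem card_compl_of_card {h : d = n + n} {α : Finset (Fin d)} (hα : α.card = n) :
    αᶜ.card = n := by
  rw [Finset.card_compl, Fintype.card_fin]
  omega

/-- The two families of relations exclude each other on matrices of full rank. -/
theorem MinorRel.not_left_inverse (h : d = n + n) (h2 : (2 : K) ≠ 0) {δ : K}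
    {Y : Matrix (Fin d) (Fin n) K} (h₁ : MinorRel δ Y) (h₂ : MinorRel (-δ) Y)
    (L : Matrix (Fin n) (Fin d) K) : L * Y ≠ 1 := by
  intro hL
  obtain ⟨α, hα, h3⟩ := exists_minor_ne_zero hL
  have hαc : αᶜ.card = n := card_compl_of_card (h := h) hα
  apply h3
  apply (mul_eq_zero.1 _).resolve_left h2
  linear_combination h₁ α hα hαc + h₂ α hα hαc

end Plucker

end SymmetricNullcone

namespace SymmetricNullcone

open Matrix Module

/-! ### Irreducibility below the middle dimension -/

section NullCone

variable {K ι : Type*} [Field K] [Fintype ι] {m a : ℕ}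

/-- The matrices with isotropic column space whose first `a` columns are orthogonal to `e`. -/
def nullCone (e : ι → K) (m a : ℕ) : Set (Matrix ι (Fin (m + 1)) K) :=
  {Y | Yᵀ * Y = 0 ∧ ∀ j : Fin (m + 1), (j : ℕ) < a → e ⬝ᵥ Y.col j = 0}

theorem frameMat_transpose_mul_self {e : ι → K} {f : Fin m → ι → K} (hf : IsFrame e f) {l : ι → K}
    (hl : l ∈ perp (Submodule.span K (Set.range f))) (hll : l ⬝ᵥ l = 0) :
    (frameMat f l)ᵀ * frameMat f l = 0 := by
  have hfl : ∀ j, f j ⬝ᵥ l = 0 := fun j => hl _ (Submodule.subset_span ⟨j, rfl⟩)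
  have hcol : ∀ j k, ((frameMat f l)ᵀ * frameMat f l) j k =
      (Fin.snoc (α := fun _ => ι → K) f l j) ⬝ᵥ (Fin.snoc (α := fun _ => ι → K) f l k) :=
    fun j k => rfl
  ext j k
  rw [hcol]
  induction j using Fin.lastCases with
  | last =>
    induction k using Fin.lastCases with
    | last => simpa using hll
    | cast k =>
      rw [Fin.snoc_last, Fin.snoc_castSucc, dotProduct_comm]
      exact hfl k
  | cast j =>
    induction k using Fin.lastCases with
    | last =>
      rw [Fin.snoc_last, Fin.snoc_castSucc]
      exact hfl j
    | cast k =>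
      rw [Fin.snoc_castSucc, Fin.snoc_castSucc]
      exact hf.dotProduct_eq_zero j k

theorem exists_left_inverse_frameMat {f : Fin m → ι → K} (hf : LinearIndependent K f) {l : ι → K}
    (hl : l ∉ Submodule.span K (Set.range f)) :
    ∃ L : Matrix (Fin (m + 1)) ι K, L * frameMat f l = 1 := by
  classical
  have h1 : LinearIndependent K (frameMat f l).col := linearIndependent_finSnoc.2 ⟨hf, hl⟩
  rw [← mulVec_injective_iff] at h1
  obtain ⟨g, hg⟩ := (frameMat f l).mulVecLin.exists_leftInverse_of_injective
    (LinearMap.ker_eq_bot.2 h1)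
  refine ⟨LinearMap.toMatrix' g, ?_⟩
  have h3 := congrArg LinearMap.toMatrix' hg
  rwa [LinearMap.toMatrix'_comp, LinearMap.toMatrix'_id, ← toLin'_apply',
    LinearMap.toMatrix'_toLin']
    at h3

variable [DecidableEq ι]

theorem mul_frameMat_mul_mem_nullCone {e : ι → K} {f : Fin m → ι → K} (hf : IsFrame e f) {l : ι → K}
    (hl : l ∈ perp (Submodule.span K (Set.range f))) (hll : l ⬝ᵥ l = 0) {g : Matrix ι ι K}
    (hg : g ∈ evenGroup (Submodule.span K {e})) {M : Matrix (Fin (m + 1)) (Fin (m + 1)) K}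
    (hM : M ∈ admissible K m a) : g * frameMat f l * M ∈ nullCone e m a := by
  constructor
  · rw [transpose_mul, transpose_mul, Matrix.mul_assoc, ← Matrix.mul_assoc (_ * gᵀ),
      ← Matrix.mul_assoc (_ * gᵀ), Matrix.mul_assoc _ gᵀ g, transpose_mul_of_mem_evenGroup hg,
      Matrix.mul_one, frameMat_transpose_mul_self hf hl hll, Matrix.zero_mul, Matrix.mul_zero]
  · intro j hj
    have h1 : (g * frameMat f l * M).col j = g *ᵥ (frameMat f l * M).col j := by
      rw [Matrix.mul_assoc]
      rfl
    have h2 : e ⬝ᵥ (frameMat f l * M).col j = 0 := by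
      have h3 : Submodule.span K (Set.range f) ≤ perp (Submodule.span K {e}) := by
        rw [Submodule.span_le]
        rintro _ ⟨k, rfl⟩
        rw [SetLike.mem_coe, mem_perp_span]
        rintro _ rfl
        exact hf.dotProduct_left k
      exact h3 (frameMat_mul_col_mem_of_lt f l hM hj) e (Submodule.mem_span_singleton_self e)
    have h3 := dotProduct_mulVec_of_mem_evenGroup hg e ((frameMat f l * M).col j)
    rw [mulVec_of_mem_evenGroup hg (Submodule.mem_span_singleton_self e), h2] at h3
    rw [h1, h3]

/-- Below the middle dimension the null cone is irreducible. -/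
theorem isZariskiIrreducible_nullCone [IsAlgClosed K] (h2 : (2 : K) ≠ 0)
    (hm : 2 * (m + 1) < Fintype.card ι) {e : ι → K} (he : e ⬝ᵥ e ≠ 0) (ha : a ≤ m) :
    IsZariskiIrreducible (toPoint '' nullCone e m a) := by
  obtain ⟨f, hf⟩ := exists_isFrame h2 hm.le e
  have hfm : finrank K (Submodule.span K (Set.range f)) = m := by
    rw [finrank_span_eq_card hf.linearIndependent, Fintype.card_fin]
  obtain ⟨l, hl, hll, hlf⟩ := exists_isotropic_notMem h2 (E := Submodule.span K (Set.range f))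
    (W := perp (Submodule.span K (Set.range f))) (by rw [finrank_perp]; omega)
  -- The second factor fixes the frame and moves l to any other permitted last vector, so S acting
  -- on the single matrix [f | l] reaches the whole null cone.
  let S : Set (Matrix ι ι K) := {p | ∃ g ∈ evenGroup (Submodule.span K {e}),
    ∃ g' ∈ evenGroup (Submodule.span K (Set.range f)), p = g * g'}
  have hS : toPoint '' nullCone e m a =
      {y | ∃ g ∈ S, ∃ M ∈ admissible K m a, y = toPoint (g * frameMat f l * M)} := by
    have hfix : ∀ g' ∈ evenGroup (Submodule.span K (Set.range f)),
        g' * frameMat f l = frameMat f (g' *ᵥ l) := by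
      intro g' hg'
      rw [mul_frameMat]
      congr 1
      funext j
      exact mulVec_of_mem_evenGroup hg' (Submodule.subset_span ⟨j, rfl⟩)
    apply Set.Subset.antisymm
    · rintro _ ⟨Y, hY, rfl⟩
      obtain ⟨g, hg, z, hz, hzz, hzf, M, hM, rfl⟩ :=
        exists_decomposition h2 hm.le he hf ha hY.1 hY.2
      obtain ⟨g', hg', rfl⟩ := exists_evenGroup_mulVec_eq h2 hz hl hzz hll hzf hlf
        (exists_mem_perp_not_isotropic_of_finrank h2 _ (by
          have h1 := Submodule.finrank_add_le_finrank_add_finrank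
            (Submodule.span K (Set.range f)) (Submodule.span K {l})
          have h3 : finrank K (Submodule.span K {l}) ≤ 1 :=
            (finrank_span_le_card {l}).trans (by simp)
          omega))
      exact ⟨g * g', ⟨g, hg, g', hg', rfl⟩, M, hM, by rw [Matrix.mul_assoc g g', hfix g' hg']⟩
    · rintro _ ⟨_, ⟨g, hg, g', hg', rfl⟩, M, hM, rfl⟩
      refine ⟨_, ?_, rfl⟩
      rw [Matrix.mul_assoc g g', hfix g' hg']
      refine mul_frameMat_mul_mem_nullCone hf ?_ ?_ hg hM
      -- The factor g' need not fix e; it suffices that g' l stays isotropic and orthogonal to the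
      -- frame.
      · intro t ht
        change t ⬝ᵥ (g' *ᵥ l) = 0
        have h1 := dotProduct_mulVec_of_mem_evenGroup hg' t l
        rw [mulVec_of_mem_evenGroup hg' ht] at h1
        exact h1.trans (hl t ht)
      · rw [dotProduct_mulVec_of_mem_evenGroup hg', hll]
  rw [hS]
  have : Infinite K := IsAlgClosed.instInfinite
  refine isZariskiIrreducible_orbit (S := S) ⟨1 * 1, 1, one_mem _, 1, one_mem _, rfl⟩ ?_ _
  rintro _ ⟨g₀, hg₀, g₀', hg₀', rfl⟩ _ ⟨g₁, hg₁, g₁', hg₁', rfl⟩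
  exact (joinedIn_evenGroup hg₀ hg₁).mul (joinedIn_evenGroup hg₀' hg₁')
    fun g hg g' hg' => ⟨g, hg, g', hg', rfl⟩

end NullCone

/-! ### The two orbits in the middle dimension -/

section MiddleDimension

variable {K ι : Type*} [Field K] [Fintype ι] [DecidableEq ι] {m a : ℕ}

/-- Two vectors spanning the isotropic lines of the orthogonal complement of a frame, interchanged
by the reflection in `w`. -/
structure IsHyperbolicPair (e : ι → K) (f : Fin m → ι → K) (w l l' : ι → K) : Prop where
  frame : IsFrame e f
  mem_perp : w ∈ perp (Submodule.span K {e})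
  not_isotropic : w ⬝ᵥ w ≠ 0
  dotProduct_frame : ∀ j, w ⬝ᵥ f j = 0
  left_mem : l ∈ perp (Submodule.span K (Set.range f))
  right_mem : l' ∈ perp (Submodule.span K (Set.range f))
  left_isotropic : l ⬝ᵥ l = 0
  right_isotropic : l' ⬝ᵥ l' = 0
  left_notMem : l ∉ Submodule.span K (Set.range f)
  right_notMem : l' ∉ Submodule.span K (Set.range f)
  reflection_left : reflection w *ᵥ l = l'
  reflection_right : reflection w *ᵥ l' = l
  mem_or_mem : ∀ x ∈ perp (Submodule.span K (Set.range f)), x ⬝ᵥ x = 0 →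
    x ∈ Submodule.span K (Set.range f) ⊔ Submodule.span K {l} ∨
      x ∈ Submodule.span K (Set.range f) ⊔ Submodule.span K {l'}

theorem IsHyperbolicPair.symm {e w l l' : ι → K} {f : Fin m → ι → K}
    (h : IsHyperbolicPair e f w l l') : IsHyperbolicPair e f w l' l where
  frame := h.frame
  mem_perp := h.mem_perp
  not_isotropic := h.not_isotropic
  dotProduct_frame := h.dotProduct_frame
  left_mem := h.right_mem
  right_mem := h.left_mem
  left_isotropic := h.right_isotropic
  right_isotropic := h.left_isotropic
  left_notMem := h.right_notMem
  right_notMem := h.left_notMem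
  reflection_left := h.reflection_right
  reflection_right := h.reflection_left
  mem_or_mem x hx hxx := (h.mem_or_mem x hx hxx).symm

/-- With F the span of the frame, e and a unit vector w orthogonal to e and F give an orthonormal
basis of the plane F^⊥/F. Its isotropic lines are spanned by e ± iw, and the reflection in w
exchanges them. -/
theorem exists_isHyperbolicPair [IsAlgClosed K] (h2 : (2 : K) ≠ 0)
    (hm : Fintype.card ι = 2 * (m + 1)) {i : K} (hi : i ^ 2 = -1) {e : ι → K} (he : e ⬝ᵥ e = 1) :
    ∃ (f : Fin m → ι → K) (w l l' : ι → K), IsHyperbolicPair e f w l l' := by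
  obtain ⟨f, hf⟩ := exists_isFrame h2 hm.ge e
  set F := Submodule.span K (Set.range f) with hF
  have hfm : finrank K F = m := by
    rw [hF, finrank_span_eq_card hf.linearIndependent, Fintype.card_fin]
  have hFF : ∀ x ∈ F, ∀ y ∈ F, x ⬝ᵥ y = 0 := by
    intro x hx y hy
    have : F ≤ perp F := by
      rw [hF, Submodule.span_le]
      rintro _ ⟨j, rfl⟩
      exact hf.mem_perp_span_range j
    exact this hy x hx
  have hFe : ∀ x ∈ F, x ⬝ᵥ e = 0 := by
    intro x hx
    have : e ∈ perp F := by
      rw [hF, mem_perp_span]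
      rintro _ ⟨j, rfl⟩
      rw [dotProduct_comm]
      exact hf.dotProduct_left j
    exact this x hx
  have hspan1 : finrank K (Submodule.span K {e}) ≤ 1 := (finrank_span_le_card {e}).trans (by simp)
  obtain ⟨w₀, hw₀, hww₀⟩ := exists_mem_perp_not_isotropic_of_mem h2 (F ⊔ Submodule.span K {e}) (by
    have h1 := Submodule.finrank_add_le_finrank_add_finrank F (Submodule.span K {e})
    omega) (Submodule.mem_sup_right (Submodule.mem_span_singleton_self e)) (by rw [he]; exact
      one_ne_zero)
  obtain ⟨c, hc⟩ := IsAlgClosed.exists_eq_mul_self (w₀ ⬝ᵥ w₀)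
  have hc0 : c ≠ 0 := by
    rintro rfl
    exact hww₀ (by rw [hc, mul_zero])
  let w := c⁻¹ • w₀
  have hw : w ∈ perp (F ⊔ Submodule.span K {e}) := Submodule.smul_mem _ _ hw₀
  have hww : w ⬝ᵥ w = 1 := by
    simp only [w, smul_dotProduct, dotProduct_smul, smul_eq_mul, hc]
    field_simp
  have hFw : ∀ x ∈ F, x ⬝ᵥ w = 0 := fun x hx => hw x (Submodule.mem_sup_left hx)
  have hew : e ⬝ᵥ w = 0 := hw e (Submodule.mem_sup_right (Submodule.mem_span_singleton_self e))
  have hwe : w ⬝ᵥ e = 0 := by rw [dotProduct_comm, hew]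
  have hii : i * i = -1 := by rw [← sq, hi]
  have hperp : perp (F ⊔ Submodule.span K {e} ⊔ Submodule.span K {w}) = F := by
    symm
    apply Submodule.eq_of_le_of_finrank_le
    · intro x hx
      rw [mem_perp_sup, mem_perp_sup]
      refine ⟨⟨fun t ht => hFF t ht x hx, mem_perp_span.2 ?_⟩, mem_perp_span.2 ?_⟩
      · rintro _ rfl
        rw [dotProduct_comm]
        exact hFe x hx
      · rintro _ rfl
        rw [dotProduct_comm]
        exact hFw x hx
    · have h1 : F < F ⊔ Submodule.span K {e} := by
        refine lt_of_le_of_ne le_sup_left fun h => ?_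
        have h3 : e ∈ F := h ▸ Submodule.mem_sup_right (Submodule.mem_span_singleton_self e)
        exact one_ne_zero (he.symm.trans (hFe e h3))
      have h3 : F ⊔ Submodule.span K {e} < F ⊔ Submodule.span K {e} ⊔ Submodule.span K {w} := by
        refine lt_of_le_of_ne le_sup_left fun h => ?_
        have h3 : w ∈ F ⊔ Submodule.span K {e} :=
          h ▸ Submodule.mem_sup_right (Submodule.mem_span_singleton_self w)
        exact one_ne_zero (hww.symm.trans (hw w h3))
      have h4 := Submodule.finrank_lt_finrank_of_lt h1
      have h5 := Submodule.finrank_lt_finrank_of_lt h3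
      rw [finrank_perp]
      omega
  have hmem : ∀ c : K, e + c • w ∈ perp F := by
    intro c x hx
    change x ⬝ᵥ (e + c • w) = 0
    rw [dotProduct_add, dotProduct_smul, hFe x hx, hFw x hx, smul_zero, add_zero]
  have hiso : ∀ c : K, (e + c • w) ⬝ᵥ (e + c • w) = 1 + c * c := by
    intro c
    simp [he, hww, hew, hwe]
  have hnot : ∀ c : K, e + c • w ∉ F := by
    intro c h
    have h1 := hFe _ h
    rw [add_dotProduct, smul_dotProduct, hwe, he, smul_zero, add_zero] at h1
    exact one_ne_zero h1
  have hrefl : ∀ c : K, reflection w *ᵥ (e + c • w) = e + (-c) • w := by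
    intro c
    rw [reflection_mulVec, hww, dotProduct_add, dotProduct_smul, hwe, hww]
    ext r
    simp
    ring
  refine ⟨f, w, e + i • w, e + (-i) • w, hf, ?_, by rw [hww]; exact one_ne_zero, ?_, hmem _, hmem _,
    ?_, ?_, hnot _, hnot _, hrefl _, ?_, ?_⟩
  · exact (mem_perp_sup.1 hw).2
  · intro j
    rw [dotProduct_comm]
    exact hFw _ (Submodule.subset_span ⟨j, rfl⟩)
  · rw [hiso, hii, add_neg_cancel]
  · rw [hiso, neg_mul_neg, hii, add_neg_cancel]
  · rw [hrefl, neg_neg]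
  · intro x hx hxx
    have hxF : ∀ t ∈ F, t ⬝ᵥ x = 0 := hx
    let y := x - (e ⬝ᵥ x) • e - (w ⬝ᵥ x) • w
    have hy : y ∈ F := by
      rw [← hperp, mem_perp_sup, mem_perp_sup]
      refine ⟨⟨fun t ht => ?_, mem_perp_span.2 ?_⟩, mem_perp_span.2 ?_⟩
      · change t ⬝ᵥ y = 0
        simp [y, dotProduct_sub, hFe t ht, hFw t ht, hxF t ht]
      · rintro _ rfl
        simp [y, dotProduct_sub, he, hew]
      · rintro _ rfl
        simp [y, dotProduct_sub, hww, hwe]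
    have hxy : x = y + (e ⬝ᵥ x) • e + (w ⬝ᵥ x) • w := by
      simp only [y]
      abel
    have hsq : (e ⬝ᵥ x) * (e ⬝ᵥ x) + (w ⬝ᵥ x) * (w ⬝ᵥ x) = 0 := by
      have hyx : y ⬝ᵥ x = 0 := hxF y hy
      have h1 : x ⬝ᵥ x = (y + (e ⬝ᵥ x) • e + (w ⬝ᵥ x) • w) ⬝ᵥ x := by rw [← hxy]
      rw [hxx, add_dotProduct, add_dotProduct, smul_dotProduct, smul_dotProduct, hyx] at h1
      simp only [smul_eq_mul] at h1
      linear_combination -h1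
    -- Over K the sum of two squares splits, one factor for each isotropic line.
    have hfac : (w ⬝ᵥ x - i * (e ⬝ᵥ x)) * (w ⬝ᵥ x + i * (e ⬝ᵥ x)) = 0 := by
      linear_combination hsq - (e ⬝ᵥ x) * (e ⬝ᵥ x) * hii
    rcases mul_eq_zero.1 hfac with h1 | h1
    · left
      have h3 : x = y + (e ⬝ᵥ x) • (e + i • w) := by
        rw [smul_add, smul_smul, ← add_assoc, mul_comm, ← sub_eq_zero.1 h1, ← hxy]
      rw [h3]
      exact Submodule.add_mem_sup hy
        (Submodule.smul_mem _ _ (Submodule.mem_span_singleton_self _))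
    · right
      have h3 : x = y + (e ⬝ᵥ x) • (e + (-i) • w) := by
        rw [smul_add, smul_smul, ← add_assoc, mul_neg, mul_comm, ← eq_neg_of_add_eq_zero_left h1,
          ← hxy]
      rw [h3]
      exact Submodule.add_mem_sup hy
        (Submodule.smul_mem _ _ (Submodule.mem_span_singleton_self _))

/-- The translates of `[f | l] M`, for `M` admissible. -/
def orbit (e : ι → K) (f : Fin m → ι → K) (a : ℕ) (l : ι → K) : Set (Matrix ι (Fin (m + 1)) K) :=
  {Y | ∃ g ∈ evenGroup (Submodule.span K {e}), ∃ M ∈ admissible K m a, Y = g * frameMat f l * M}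

theorem isZariskiIrreducible_image_orbit [Infinite K] (e : ι → K) (f : Fin m → ι → K) (a : ℕ)
    (l : ι → K) : IsZariskiIrreducible (toPoint '' orbit e f a l) := by
  have h : toPoint '' orbit e f a l =
      {y | ∃ g ∈ (evenGroup (Submodule.span K {e}) : Set (Matrix ι ι K)),
      ∃ M ∈ admissible K m a,
        y = toPoint (g * frameMat f l * M : Matrix ι (Fin (m + 1)) K)} := by
    ext y
    constructor
    · rintro ⟨_, ⟨g, hg, M, hM, rfl⟩, rfl⟩
      exact ⟨g, hg, M, hM, rfl⟩
    · rintro ⟨g, hg, M, hM, rfl⟩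
      exact ⟨_, ⟨g, hg, M, hM, rfl⟩, rfl⟩
  rw [h]
  exact isZariskiIrreducible_orbit ⟨1, one_mem _⟩
    (fun g₀ hg₀ g₁ hg₁ => joinedIn_evenGroup hg₀ hg₁) _

theorem frameMat_mem_orbit (e : ι → K) (f : Fin m → ι → K) (ha : a ≤ m) (l : ι → K) :
    frameMat f l ∈ orbit e f a l := by
  refine ⟨1, one_mem _, 1, fun j hj => one_apply_ne fun h => ?_,
    by rw [Matrix.one_mul, Matrix.mul_one]⟩
  rw [← h, Fin.val_last] at hj
  omega

theorem IsHyperbolicPair.orbit_subset {e w l l' : ι → K} {f : Fin m → ι → K}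
    (h : IsHyperbolicPair e f w l l') : orbit e f a l ⊆ nullCone e m a := by
  rintro _ ⟨g, hg, M, hM, rfl⟩
  exact mul_frameMat_mul_mem_nullCone h.frame h.left_mem h.left_isotropic hg hM

theorem IsHyperbolicPair.nullCone_eq [IsAlgClosed K] (h2 : (2 : K) ≠ 0)
    (hm : Fintype.card ι = 2 * (m + 1)) {e w l l' : ι → K} (he : e ⬝ᵥ e ≠ 0) {f : Fin m → ι → K}
    (h : IsHyperbolicPair e f w l l') (ha : a ≤ m) :
    nullCone e m a = orbit e f a l ∪ orbit e f a l' := by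
  apply Set.Subset.antisymm
  · rintro Y ⟨hY, hYa⟩
    obtain ⟨g, hg, z, hz, hzz, -, M, hM, rfl⟩ := exists_decomposition h2 hm.ge he h.frame ha hY hYa
    rcases h.mem_or_mem z hz hzz with h1 | h1
    · left
      obtain ⟨M', hM', h3⟩ := exists_frameMat_mul_eq_of_mem hM h1
      exact ⟨g, hg, M', hM', by rw [Matrix.mul_assoc, h3, ← Matrix.mul_assoc]⟩
    · right
      obtain ⟨M', hM', h3⟩ := exists_frameMat_mul_eq_of_mem hM h1
      exact ⟨g, hg, M', hM', by rw [Matrix.mul_assoc, h3, ← Matrix.mul_assoc]⟩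
  · exact Set.union_subset h.orbit_subset h.symm.orbit_subset

theorem IsHyperbolicPair.reflection_mul_frameMat {e w l l' : ι → K} {f : Fin m → ι → K}
    (h : IsHyperbolicPair e f w l l') : reflection w * frameMat f l = frameMat f l' := by
  rw [mul_frameMat, h.reflection_left]
  congr 1
  funext j
  exact reflection_mulVec_of_perp (h.dotProduct_frame j)

/-- Matrices of smaller rank lie in both orbits. -/
theorem IsHyperbolicPair.mem_orbit_of_det_eq_zero (h2 : (2 : K) ≠ 0)
    (hm : Fintype.card ι = 2 * (m + 1)) {e w l l' : ι → K} (he : e ⬝ᵥ e ≠ 0) {f : Fin m → ι → K}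
    (h : IsHyperbolicPair e f w l l') {g : Matrix ι ι K}
    (hg : g ∈ evenGroup (Submodule.span K {e})) {M : Matrix (Fin (m + 1)) (Fin (m + 1)) K}
    (hM : M ∈ admissible K m a) (hdet : M.det = 0) : g * frameMat f l' * M ∈ orbit e f a l := by
  have hrank : finrank K (Submodule.span K (Set.range (frameMat f l' * M).col)) ≤ m := by
    rw [← rank_eq_finrank_span_cols]
    refine (rank_mul_le_right _ _).trans ?_
    by_contra hcon
    have h1 : M.rank = Fintype.card (Fin (m + 1)) := by
      have := M.rank_le_card_width
      rw [Fintype.card_fin] at this ⊢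
      omega
    have h3 : IsUnit M := by
      rw [← mulVec_surjective_iff_isUnit]
      have h4 : LinearMap.range M.mulVecLin = ⊤ := by
        apply Submodule.eq_top_of_finrank_eq
        rw [finrank_fintype_fun_eq_card]
        exact h1
      exact LinearMap.range_eq_top.1 h4
    rw [isUnit_iff_isUnit_det, hdet] at h3
    exact not_isUnit_zero h3
  -- The rank drop leaves a non-isotropic v orthogonal to e and all columns. Its reflection fixes
  -- the matrix, so composing with the reflection in w switches l' to l by an even product.
  obtain ⟨v, hv, hvv⟩ := exists_mem_perp_not_isotropic_of_mem h2
    (Submodule.span K {e} ⊔ Submodule.span K (Set.range (frameMat f l' * M).col)) (by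
      have h1 := Submodule.finrank_add_le_finrank_add_finrank (Submodule.span K {e})
        (Submodule.span K (Set.range (frameMat f l' * M).col))
      have h3 : finrank K (Submodule.span K {e}) ≤ 1 := (finrank_span_le_card {e}).trans (by simp)
      omega) (Submodule.mem_sup_left (Submodule.mem_span_singleton_self e)) he
  rw [mem_perp_sup] at hv
  have hfix : reflection v * (frameMat f l' * M) = frameMat f l' * M := by
    refine col_injective fun j => ?_
    change reflection v *ᵥ (frameMat f l' * M).col j = _
    apply reflection_mulVec_of_perp
    rw [dotProduct_comm]
    exact hv.2 _ (Submodule.subset_span ⟨j, rfl⟩)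
  refine ⟨g * (reflection v * reflection w), mul_mem hg
    (mul_reflection_mem hv.1 h.mem_perp hvv h.not_isotropic), M, hM, ?_⟩
  rw [Matrix.mul_assoc, ← hfix, ← h.reflection_mul_frameMat]
  simp only [Matrix.mul_assoc]

end MiddleDimension

end SymmetricNullcone

namespace SymmetricNullcone

open MvPolynomial Matrix

/-! ### Translation between ideals and sets of matrices -/

section ZeroSets

variable {K : Type*} [Field K] {d n : ℕ}

theorem zeroLocus_sup {σ : Type*} (I J : Ideal (MvPolynomial σ K)) :
    zeroLocus K (I ⊔ J) = zeroLocus K I ∩ zeroLocus K J := by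
  apply Set.Subset.antisymm
  · exact Set.subset_inter (zeroLocus_anti_mono le_sup_left) (zeroLocus_anti_mono le_sup_right)
  · rintro x ⟨h1, h2⟩
    rw [mem_zeroLocus_iff]
    intro p hp
    obtain ⟨a, ha, b, hb, rfl⟩ := Submodule.mem_sup.1 hp
    rw [map_add, mem_zeroLocus_iff.1 h1 a ha, mem_zeroLocus_iff.1 h2 b hb, add_zero]

theorem eq_toPoint_image {K ι κ : Type*} {Z : Set (ι × κ → K)} {S : Set (Matrix ι κ K)}
    (h : ∀ Y, toPoint Y ∈ Z ↔ Y ∈ S) : Z = toPoint '' S := by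
  ext x
  constructor
  · intro hx
    exact ⟨of fun r j => x (r, j), (h _).1 hx, rfl⟩
  · rintro ⟨Y, hY, rfl⟩
    exact (h Y).2 hY

theorem toPoint_injective {K ι κ : Type*} :
    Function.Injective (toPoint : Matrix ι κ K → ι × κ → K) := by
  intro X Y h
  ext r j
  exact congrFun h (r, j)

theorem aeval_genMatrix (Y : Matrix (Fin d) (Fin n) K) (r : Fin d) (j : Fin n) :
    aeval (toPoint Y) (genMatrix K d n r j) = Y r j :=
  aeval_X (toPoint Y) (r, j)

theorem toPoint_mem_zeroLocus_gramIdeal {Y : Matrix (Fin d) (Fin n) K} :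
    toPoint Y ∈ zeroLocus K (gramIdeal K d n) ↔ Yᵀ * Y = 0 := by
  have key : ∀ j k, aeval (toPoint Y) (((genMatrix K d n)ᵀ * genMatrix K d n) j k) =
      (Yᵀ * Y) j k := by
    intro j k
    simp only [mul_apply, transpose_apply, map_sum, map_mul, aeval_genMatrix]
  rw [gramIdeal, zeroLocus_span]
  constructor
  · intro h
    ext j k
    rw [← key]
    exact h _ ⟨j, k, rfl⟩
  · rintro h _ ⟨j, k, rfl⟩
    rw [key, h]
    rfl

theorem toPoint_mem_zeroLocus_rowIdeal (hd : 0 < d) {a : ℕ} {Y : Matrix (Fin d) (Fin n) K} :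
    toPoint Y ∈ zeroLocus K (rowIdeal K d n a) ↔
      ∀ j : Fin n, (j : ℕ) < a → Pi.single ⟨0, hd⟩ 1 ⬝ᵥ Y.col j = 0 := by
  simp only [single_one_dotProduct, col_apply]
  rw [rowIdeal, zeroLocus_span]
  constructor
  · intro h j hj
    exact (aeval_genMatrix Y ⟨0, hd⟩ j).symm.trans (h _ ⟨_, j, rfl, hj, rfl⟩)
  · rintro h _ ⟨r, j, hr, hj, rfl⟩
    rw [aeval_genMatrix, ← h j hj]
    congr 1
    exact Fin.ext hr

theorem rowIdeal_zero : rowIdeal K d n 0 = ⊥ := by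
  rw [rowIdeal, Ideal.span_eq_bot]
  rintro _ ⟨r, j, -, hj, -⟩
  exact absurd hj (Nat.not_lt_zero _)

theorem zeroLocus_gramIdeal_sup_rowIdeal (hd : 0 < d) (m a : ℕ) :
    zeroLocus K (gramIdeal K d (m + 1) ⊔ rowIdeal K d (m + 1) a) =
      toPoint '' nullCone (Pi.single ⟨0, hd⟩ 1) m a := by
  apply eq_toPoint_image
  intro Y
  rw [zeroLocus_sup, Set.mem_inter_iff, toPoint_mem_zeroLocus_gramIdeal,
    toPoint_mem_zeroLocus_rowIdeal hd]
  rfl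

/-- For d = 2n this removes the minors of size d/2 + 1 = n + 1, so `idealS` reduces to the Gram
ideal. -/
theorem minorsIdeal_eq_bot {k : ℕ} (h : n < k) : minorsIdeal K d n k = ⊥ := by
  rw [minorsIdeal, Ideal.span_eq_bot]
  rintro _ ⟨-, c, -⟩
  have := Fintype.card_le_of_injective c c.injective
  rw [Fintype.card_fin, Fintype.card_fin] at this
  omega

theorem aeval_minorDet (Y : Matrix (Fin d) (Fin n) K) (α : Finset (Fin d)) (hα : α.card = n)
    (β : Finset (Fin n)) (hβ : β.card = n) :
    aeval (toPoint Y) (minorDet K α hα β hβ) = (Y.submatrix (α.orderEmbOfFin hα) id).det := by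
  have hβ' : ⇑(β.orderEmbOfFin hβ) = id := by
    have h1 : β = Finset.univ := (Finset.card_eq_iff_eq_univ β).1 (by rw [hβ, Fintype.card_fin])
    exact (Finset.orderEmbOfFin_unique hβ (fun j => h1 ▸ Finset.mem_univ _) strictMono_id).symm
  rw [minorDet, hβ', AlgHom.map_det]
  congr 1
  ext r j
  exact aeval_genMatrix Y _ _

theorem toPoint_mem_zeroLocus_idealP (h : d = n + n) (i : K) {Y : Matrix (Fin d) (Fin n) K} :
    toPoint Y ∈ zeroLocus K (idealP i d n n) ↔ Yᵀ * Y = 0 ∧ MinorRel (i ^ n) Y := by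
  rw [idealP, idealS, minorsIdeal_eq_bot (by omega), sup_bot_eq, zeroLocus_sup, Set.mem_inter_iff,
    toPoint_mem_zeroLocus_gramIdeal, zeroLocus_span]
  refine and_congr_right fun _ => ⟨fun h1 α hα hαc => ?_, ?_⟩
  · have h3 := h1 _ ⟨α, hα, hαc, Finset.univ, Finset.card_fin n, rfl⟩
    simp only [map_sub, map_mul, map_intCast, aeval_minorDet, algHom_C, Algebra.algebraMap_self,
      RingHom.id_apply] at h3
    exact sub_eq_zero.1 h3
  · rintro h1 _ ⟨α, hα, hαc, β, hβ, rfl⟩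
    simp only [map_sub, map_mul, map_intCast, aeval_minorDet, algHom_C, Algebra.algebraMap_self,
      RingHom.id_apply]
    exact sub_eq_zero.2 (h1 α hα hαc)

theorem toPoint_mem_zeroLocus_idealQ (h : d = n + n) (i : K) {Y : Matrix (Fin d) (Fin n) K} :
    toPoint Y ∈ zeroLocus K (idealQ i d n n) ↔ Yᵀ * Y = 0 ∧ MinorRel (-i ^ n) Y := by
  rw [idealQ, idealS, minorsIdeal_eq_bot (by omega), sup_bot_eq, zeroLocus_sup, Set.mem_inter_iff,
    toPoint_mem_zeroLocus_gramIdeal, zeroLocus_span]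
  refine and_congr_right fun _ => ⟨fun h1 α hα hαc => ?_, ?_⟩
  · have h3 := h1 _ ⟨α, hα, hαc, Finset.univ, Finset.card_fin n, rfl⟩
    simp only [map_add, map_mul, map_intCast, aeval_minorDet, algHom_C, Algebra.algebraMap_self,
      RingHom.id_apply] at h3
    linear_combination h3
  · rintro h1 _ ⟨α, hα, hαc, β, hβ, rfl⟩
    simp only [map_add, map_mul, map_intCast, aeval_minorDet, algHom_C, Algebra.algebraMap_self,
      RingHom.id_apply]
    linear_combination h1 α hα hαc

theorem zeroLocus_idealP_sup_rowIdeal (hd : 0 < d) {m : ℕ} (h : d = (m + 1) + (m + 1)) (i : K)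
    (a : ℕ) : zeroLocus K (idealP i d (m + 1) (m + 1) ⊔ rowIdeal K d (m + 1) a) =
      toPoint '' {Y | Y ∈ nullCone (Pi.single ⟨0, hd⟩ 1) m a ∧ MinorRel (i ^ (m + 1)) Y} := by
  apply eq_toPoint_image
  intro Y
  rw [zeroLocus_sup, Set.mem_inter_iff, toPoint_mem_zeroLocus_idealP h,
    toPoint_mem_zeroLocus_rowIdeal hd, and_right_comm]
  rfl

theorem zeroLocus_idealQ_sup_rowIdeal (hd : 0 < d) {m : ℕ} (h : d = (m + 1) + (m + 1)) (i : K)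
    (a : ℕ) : zeroLocus K (idealQ i d (m + 1) (m + 1) ⊔ rowIdeal K d (m + 1) a) =
      toPoint '' {Y | Y ∈ nullCone (Pi.single ⟨0, hd⟩ 1) m a ∧ MinorRel (-i ^ (m + 1)) Y} := by
  apply eq_toPoint_image
  intro Y
  rw [zeroLocus_sup, Set.mem_inter_iff, toPoint_mem_zeroLocus_idealQ h,
    toPoint_mem_zeroLocus_rowIdeal hd, and_right_comm]
  rfl

end ZeroSets

/-! ### Identification of the components and the intersection formula -/

section Components

variable {K : Type*} [Field K] {d m a : ℕ}

theorem selfDual_of_mem_orbit {h : d = (m + 1) + (m + 1)} {δ : K} {e l : Fin d → K}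
    {f : Fin m → Fin d → K} (hf : SelfDual h δ (frameMat f l)) {Y : Matrix (Fin d) (Fin (m + 1)) K}
    (hY : Y ∈ orbit e f a l) : SelfDual h δ Y := by
  obtain ⟨g, hg, M, -, rfl⟩ := hY
  have h1 := (hf.mul_left (transpose_mul_of_mem_evenGroup hg)).mul_right M
  rwa [det_of_mem_evenGroup hg, mul_one] at h1

/-- Each orbit is cut out by one of the two families of relations between the minors. -/
theorem IsHyperbolicPair.orbit_eq [IsAlgClosed K] (h2 : (2 : K) ≠ 0)
    (hd : d = (m + 1) + (m + 1)) {e w l l' : Fin d → K} (he : e ⬝ᵥ e ≠ 0) {f : Fin m → Fin d → K}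
    (h : IsHyperbolicPair e f w l l') (ha : a ≤ m) {δ : K} (hl : SelfDual hd δ (frameMat f l))
    (hl' : SelfDual hd (-δ) (frameMat f l')) :
    {Y | Y ∈ nullCone e m a ∧ MinorRel δ Y} = orbit e f a l := by
  have hcard : Fintype.card (Fin d) = 2 * (m + 1) := by rw [Fintype.card_fin]; omega
  apply Set.Subset.antisymm
  · rintro Y ⟨hY, hYδ⟩
    rw [h.nullCone_eq h2 hcard he ha] at hY
    rcases hY with hY | hY
    · exact hY
    · have h1 := (selfDual_of_mem_orbit hl' hY).minorRel
      obtain ⟨g, hg, M, hM, rfl⟩ := hY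
      refine h.mem_orbit_of_det_eq_zero h2 hcard he hg hM ?_
      -- An invertible M would give Y a left inverse, while Y satisfies the relations for both δ and
      -- -δ.
      by_contra hdet
      obtain ⟨L, hL⟩ := exists_left_inverse_frameMat h.frame.linearIndependent h.right_notMem
      refine hYδ.not_left_inverse hd h2 h1 (M⁻¹ * (L * gᵀ)) ?_
      have h3 : L * gᵀ * (g * frameMat f l') = 1 := by
        rw [Matrix.mul_assoc, ← Matrix.mul_assoc gᵀ, transpose_mul_of_mem_evenGroup hg,
          Matrix.one_mul, hL]
      rw [Matrix.mul_assoc, ← Matrix.mul_assoc (L * gᵀ), h3, Matrix.one_mul,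
        nonsing_inv_mul _ (isUnit_iff_ne_zero.2 hdet)]
  · intro Y hY
    exact ⟨h.orbit_subset hY, (selfDual_of_mem_orbit hl hY).minorRel⟩

/-- The sign for l is not known in advance; since the reflection in w negates it, exchanging l and
l' if necessary matches l with 𝔓 and l' with 𝔔. -/
theorem exists_isHyperbolicPair_selfDual [IsAlgClosed K] (h2 : (2 : K) ≠ 0)
    (hd : d = (m + 1) + (m + 1)) {i : K} (hi : i ^ 2 = -1) {e : Fin d → K} (he : e ⬝ᵥ e = 1) :
    ∃ (f : Fin m → Fin d → K) (w l l' : Fin d → K), IsHyperbolicPair e f w l l' ∧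
      SelfDual hd (i ^ (m + 1)) (frameMat f l) ∧ SelfDual hd (-i ^ (m + 1)) (frameMat f l') := by
  obtain ⟨f, w, l, l', h⟩ :=
    exists_isHyperbolicPair (m := m) h2 (by rw [Fintype.card_fin]; omega) hi he
  have hswap : ∀ δ : K, SelfDual hd δ (frameMat f l) → SelfDual hd (-δ) (frameMat f l') := by
    intro δ hδ
    have h1 := hδ.mul_left (g := reflection w) (by rw [reflection_transpose, reflection_mul_self])
    rwa [det_reflection h.not_isotropic, h.reflection_mul_frameMat, mul_neg_one] at h1
  obtain ⟨L, hL⟩ := exists_left_inverse_frameMat h.frame.linearIndependent h.left_notMem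
  rcases exists_selfDual hd hi (Z := Lᵀ) (by rw [transpose_transpose, hL])
    (frameMat_transpose_mul_self h.frame h.left_mem h.left_isotropic) with h1 | h1
  · exact ⟨f, w, l, l', h, h1, hswap _ h1⟩
  · refine ⟨f, w, l', l, h.symm, ?_, h1⟩
    have h3 := hswap _ h1
    rwa [neg_neg] at h3

theorem SelfDual.not_minorRel_frameMat (h2 : (2 : K) ≠ 0) {h : d = (m + 1) + (m + 1)} {δ : K}
    {f : Fin m → Fin d → K} {l : Fin d → K} (hf : LinearIndependent K f)
    (hl : l ∉ Submodule.span K (Set.range f)) (hδ : SelfDual h δ (frameMat f l)) :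
    ¬ MinorRel (-δ) (frameMat f l) := by
  intro h1
  obtain ⟨L, hL⟩ := exists_left_inverse_frameMat hf hl
  exact hδ.minorRel.not_left_inverse h h2 h1 L hL

theorem zariskiComponents_zeroLocus_gramIdeal_sup_rowIdeal [IsAlgClosed K] (h2 : (2 : K) ≠ 0)
    (hd : d = (m + 1) + (m + 1)) {i : K} (hi : i ^ 2 = -1) (ha : a ≤ m) :
    let V := zeroLocus K (gramIdeal K d (m + 1) ⊔ rowIdeal K d (m + 1) a)
    let VP := zeroLocus K (idealP i d (m + 1) (m + 1) ⊔ rowIdeal K d (m + 1) a)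
    let VQ := zeroLocus K (idealQ i d (m + 1) (m + 1) ⊔ rowIdeal K d (m + 1) a)
    V = VP ∪ VQ ∧ zariskiComponents V = {VP, VQ} ∧ VP ≠ VQ := by
  intro V VP VQ
  have hd0 : 0 < d := by omega
  let e : Fin d → K := Pi.single ⟨0, hd0⟩ 1
  have he : e ⬝ᵥ e = 1 := by simp [e]
  have he0 : e ⬝ᵥ e ≠ 0 := by rw [he]; exact one_ne_zero
  obtain ⟨f, w, l, l', h, hl, hl'⟩ := exists_isHyperbolicPair_selfDual h2 hd hi he
  have hP : VP = toPoint '' orbit e f a l := by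
    simp only [VP]
    rw [zeroLocus_idealP_sup_rowIdeal hd0 hd, h.orbit_eq h2 hd he0 ha hl hl']
  have hQ : VQ = toPoint '' orbit e f a l' := by
    simp only [VQ]
    rw [zeroLocus_idealQ_sup_rowIdeal hd0 hd,
      h.symm.orbit_eq h2 hd he0 ha hl' (by rwa [neg_neg])]
  have hV : V = VP ∪ VQ := by
    rw [hP, hQ, ← Set.image_union,
      ← h.nullCone_eq h2 (by rw [Fintype.card_fin]; omega) he0 ha]
    exact zeroLocus_gramIdeal_sup_rowIdeal hd0 m a
  have hPQ : ¬ VP ⊆ VQ := by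
    intro hsub
    rw [hP, hQ, Set.image_subset_image_iff toPoint_injective] at hsub
    exact hl.not_minorRel_frameMat h2 h.frame.linearIndependent h.left_notMem
      (selfDual_of_mem_orbit hl' (hsub (frameMat_mem_orbit e f ha l))).minorRel
  have hQP : ¬ VQ ⊆ VP := by
    intro hsub
    rw [hP, hQ, Set.image_subset_image_iff toPoint_injective] at hsub
    refine hl'.not_minorRel_frameMat h2 h.frame.linearIndependent h.right_notMem ?_
    rw [neg_neg]
    exact (selfDual_of_mem_orbit hl (hsub (frameMat_mem_orbit e f ha l'))).minorRel
  refine ⟨hV, zariskiComponents_eq_pair hV ?_ ?_ hPQ hQP, fun heq => hPQ heq.subset⟩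
  · change IsZariskiIrreducible VP
    rw [hP]
    exact isZariskiIrreducible_image_orbit e f a l
  · change IsZariskiIrreducible VQ
    rw [hQ]
    exact isZariskiIrreducible_image_orbit e f a l'

/-- Neither 𝔓 nor 𝔔 has to be known radical: 𝔓 ∩ 𝔔 vanishes on V(YᵗY), hence lies in the radical of
the Gram ideal, which is that ideal itself. -/
theorem gramIdeal_eq_inf [IsAlgClosed K] (h2 : (2 : K) ≠ 0) (hd : d = (m + 1) + (m + 1)) {i : K}
    (hi : i ^ 2 = -1) : gramIdeal K d (m + 1) =
      idealP i d (m + 1) (m + 1) ⊓ idealQ i d (m + 1) (m + 1) := by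
  apply le_antisymm
  · exact le_inf (le_sup_left.trans le_sup_left) (le_sup_left.trans le_sup_left)
  -- The case a = 0, where the row ideal is zero.
  · have h1 := (zariskiComponents_zeroLocus_gramIdeal_sup_rowIdeal h2 hd hi m.zero_le).1
    rw [rowIdeal_zero, sup_bot_eq, sup_bot_eq, sup_bot_eq, zeroLocus_union] at h1
    rw [← (isRadical_gramIdeal h2 hi hd).radical,
      ← vanishingIdeal_zeroLocus_eq_radical (K := K), h1]
    exact le_vanishingIdeal_zeroLocus _

end Components

end SymmetricNullcone
end

/-! ### The main theorem -/

theorem mainTheorem5 {K : Type*} [Field K] [IsAlgClosed K] (hK : ringChar K ≠ 2)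
    (i : K) (hi : i ^ 2 = -1) (d n a : ℕ) (hd : 0 < d) (hn : 0 < n) (hnd : 2 * n ≤ d)
    (ha : a < n) :
    (2 * n < d →
      SymmetricNullcone.IsZariskiIrreducible
        (MvPolynomial.zeroLocus K
          (SymmetricNullcone.gramIdeal K d n ⊔ SymmetricNullcone.rowIdeal K d n a))) ∧
    (d = 2 * n →
      SymmetricNullcone.zariskiComponents
        (MvPolynomial.zeroLocus K
          (SymmetricNullcone.gramIdeal K d n ⊔ SymmetricNullcone.rowIdeal K d n a)) =
        {MvPolynomial.zeroLocus K
          (SymmetricNullcone.idealP i d n n ⊔ SymmetricNullcone.rowIdeal K d n a),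
         MvPolynomial.zeroLocus K
          (SymmetricNullcone.idealQ i d n n ⊔ SymmetricNullcone.rowIdeal K d n a)} ∧
      MvPolynomial.zeroLocus K
          (SymmetricNullcone.idealP i d n n ⊔ SymmetricNullcone.rowIdeal K d n a) ≠
        MvPolynomial.zeroLocus K
          (SymmetricNullcone.idealQ i d n n ⊔ SymmetricNullcone.rowIdeal K d n a) ∧
      (SymmetricNullcone.gramIdeal K d n).IsRadical ∧
      SymmetricNullcone.gramIdeal K d n =
        SymmetricNullcone.idealP i d n n ⊓ SymmetricNullcone.idealQ i d n n) := by
  have h2 : (2 : K) ≠ 0 := Ring.two_ne_zero hK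
  obtain ⟨m, rfl⟩ := Nat.exists_eq_succ_of_ne_zero hn.ne'
  constructor
  · intro h
    rw [SymmetricNullcone.zeroLocus_gramIdeal_sup_rowIdeal hd]
    exact SymmetricNullcone.isZariskiIrreducible_nullCone h2 (by rwa [Fintype.card_fin])
      (by simp) (Nat.lt_succ_iff.1 ha)
  · intro h
    have h' : d = (m + 1) + (m + 1) := by omega
    obtain ⟨-, h3, h4⟩ :=
      SymmetricNullcone.zariskiComponents_zeroLocus_gramIdeal_sup_rowIdeal h2 h' hi
        (Nat.lt_succ_iff.1 ha)
    exact ⟨h3, h4, SymmetricNullcone.isRadical_gramIdeal h2 hi h',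
      SymmetricNullcone.gramIdeal_eq_inf h2 h' hi⟩
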